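/- Let $F$ be a non-archimedean local field with ring of integers $\mathfrak o$ and uniformizer $\varpi$, $G=\mathrm{GL}_{2n}(F)$, $P\subset G$ the Borel subgroup of upper triangular matrices, $\delta$ its modular character ($\int_P f(xp)\,dx=\delta(p)\int_P f(x)\,dx$ for left Haar measure), and $B$ the standard Iwahori subgroup (matrices in $\mathrm{GL}_{2n}(\mathfrak o)$ that are upper triangular modulo the maximal ideal). For a character $\eta=(\eta_1,\dots,\eta_{2n})$ of $P$, where the $\eta_i$ are unramified characters of $F^\times$, let $I(\eta)$ be the space of locally constant $f:G\to\mathbb C$ with $f(pg)=\eta\delta^{1/2}(p)f(g)$, on which $G$ acts by right translation $R$, and let $\mathcal P_\eta:C_c^\infty(G)\to I(\eta)$, $\mathcal P_\eta(f)(g)=\int_P\eta^{-1}\delta^{1/2}(p)f(pg)\,dp$ (left Haar measure). The Weyl group $W=S_{2n}$ acts on characters by $({}^w\eta)_i=\eta_{w^{-1}(i)}$, and $\Gamma\subset W$, the Weyl group of $\mathrm{Sp}_{2n}$, is the subgroup of permutations commuting with $i\mapsto 2n+1-i$. Let $\chi=(\chi_1,\dots,\chi_n,\chi_n^{-1},\dots,\chi_1^{-1})$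 with unramified $\chi_i$ such that $\chi_i\neq\chi_j^{\pm1}$ for $i\neq j$. Let $S$ be the Shalika subgroup of matrices $s=\begin{pmatrix}g&\\&g\end{pmatrix}\begin{pmatrix}I&X\\&I\end{pmatrix}$, $\Psi(s)=\psi(\operatorname{tr}X)$ with $\psi$ an additive character of $F$ of conductor $\mathfrak o$, and let $\Lambda$ be a Shalika functional on $I(\chi)$, i.e. a linear functional with $\Lambda(R_s\phi)=\Psi(s)\Lambda(\phi)$ for $s\in S$. Put $\xi=\begin{pmatrix}&I\\w_0&\end{pmatrix}$ with $w_0$ the antidiagonal permutation matrix, $H=\xi S\xi^{-1}$, $\Lambda_H(\phi)=\Lambda(R_{\xi^{-1}}\phi)$, and let $\Delta_H=\Lambda_H\circ\mathcal P_\chi$ be the corresponding distribution on $G$. (1) Let $w\in W\setminus\Gamma$ and let $T: I({}^w\chi)\to I(\chi)$ be any $G$-equivariant linear map (for instance the standard intertwining operator $T_{w^{-1}}$). Then the distribution $T^*\Delta_H:=\Lambda_H\circ T\circ\mathcal P_{{}^w\chi}$ is supported away from $P\cdot H$: it vanishes on every $f\in C_c^\infty(G)$ with $\operatorname{supp} f\subset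 P\cdot H$. (2) For every $w\in W$ let $T_w:I(\chi^{-1})\to I({}^w\chi^{-1})$ be $G$-equivariant linear maps (for instance the standard intertwining operators), and suppose that $\{f_w\}_{w\in W}$ is the Casselman basis of the Iwahori invariants $I(\chi^{-1})^B$, i.e. the basis dual to the functionals $\phi\mapsto T_w(\phi)(1)$. For $g\in G$ let $R_BR_{g^{-1}}\Delta_H\in I(\chi^{-1})^B$ be the function $x\mapsto\Delta_H(R_g 1_{xB})$, and define the Casselman coefficients $a_w(g)$ by $$R_BR_{g^{-1}}\Delta_H=\sum_{w\in W}a_w(g)f_w .$$ Then for all integers $\lambda_1\ge\dots\ge\lambda_n$ and all $w\in W\setminus\Gamma$, $$a_w(g_{-\lambda})=0,\qquad g_{-\lambda}=\operatorname{diag}(\varpi^{-\lambda_1},\dots,\varpi^{-\lambda_n},1,\dots,1).$$ -/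

import Mathlib

open MeasureTheory

noncomputable section

namespace Shalika

variable {F : Type*} [NontriviallyNormedField F] {n : ℕ}

/-- Row and column indices of `2n × 2n` matrices: the left summand is the first block of `n`
indices, the right summand the second block. -/
abbrev Idx (n : ℕ) : Type := Fin n ⊕ Fin n

/-- The group `G = GL_{2n}(F)`, with its topology as a group of units. -/
abbrev Grp (n : ℕ) (F : Type*) [NontriviallyNormedField F] : Type _ :=
  Matrix.GeneralLinearGroup (Idx n) F

/-- The position `0, …, 2n - 1` of an index. -/
def pos (i : Idx n) : Fin (n + n) := finSumFinEquiv i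

lemma pos_injective : Function.Injective (pos (n := n)) := finSumFinEquiv.injective

/-! ### The Borel subgroup, its characters and its modular character -/

/-- Upper triangular matrices. -/
def IsUpper (M : Matrix (Idx n) (Idx n) F) : Prop := ∀ i j, pos j < pos i → M i j = 0

lemma IsUpper.mul {A B : Matrix (Idx n) (Idx n) F} (hA : IsUpper A) (hB : IsUpper B) :
    IsUpper (A * B) := by
  intro i j hij
  rw [Matrix.mul_apply]
  refine Finset.sum_eq_zero fun k _ => ?_
  rcases lt_or_ge (pos k) (pos i) with h | h
  · rw [hA i k h, zero_mul]
  · rw [hB k j (lt_of_lt_of_le hij h), mul_zero]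

lemma IsUpper.mul_diag {A B : Matrix (Idx n) (Idx n) F} (hA : IsUpper A) (hB : IsUpper B)
    (i : Idx n) : (A * B) i i = A i i * B i i := by
  rw [Matrix.mul_apply]
  refine Finset.sum_eq_single i (fun k _ hk => ?_) (by simp)
  rcases lt_or_gt_of_ne (fun h => hk (pos_injective h)) with h | h
  · rw [hA i k h, zero_mul]
  · rw [hB k i h, mul_zero]

/-- The Borel subgroup `P` of upper triangular matrices in `G`. -/
def borelSubgroup (n : ℕ) (F : Type*) [NontriviallyNormedField F] : Subgroup (Grp n F) where
  carrier := {g | IsUpper (g : Matrix (Idx n) (Idx n) F)}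
  one_mem' := fun i j hij =>
    Matrix.one_apply_ne fun h => absurd hij (by rw [h]; exact lt_irrefl _)
  mul_mem' := fun ha hb => IsUpper.mul ha hb
  inv_mem' := by
    intro g hg
    have h : Matrix.BlockTriangular (g : Matrix (Idx n) (Idx n) F) pos := fun i j hij => hg i j hij
    have : Invertible (g : Matrix (Idx n) (Idx n) F) := g.invertible
    have h2 := Matrix.blockTriangular_inv_of_blockTriangular h
    intro i j hij
    rw [Matrix.coe_units_inv]
    exact h2 hij

/-- The diagonal entries of an element of `P`. -/
def diagPart : borelSubgroup n F →* (Idx n → Fˣ) where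
  toFun p i :=
    { val := (p : Grp n F) i i
      inv := ((p⁻¹ : borelSubgroup n F) : Grp n F) i i
      val_inv := by
        rw [← IsUpper.mul_diag p.2 (p⁻¹).2, ← Units.val_mul, ← Subgroup.coe_mul]; simp
      inv_val := by
        rw [← IsUpper.mul_diag (p⁻¹).2 p.2, ← Units.val_mul, ← Subgroup.coe_mul]; simp }
  map_one' := by ext i; simp
  map_mul' p q := by
    ext i
    simpa using IsUpper.mul_diag p.2 q.2 i

/-- A character of `Fˣ` is unramified if it is trivial on the units of the ring of integers. -/
def IsUnramified (η : Fˣ →* ℂˣ) : Prop := ∀ u : Fˣ, ‖(u : F)‖ = 1 → η u = 1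

/-- The character `χ(p) = χ_1(p_{11}) ⋯ χ_{2n}(p_{2n,2n})` of `P`. -/
def borelChar (χ : Idx n → Fˣ →* ℂˣ) : borelSubgroup n F →* ℂˣ where
  toFun p := ∏ i, χ i (diagPart p i)
  map_one' := by simp
  map_mul' p q := by simp [Finset.prod_mul_distrib]

/-- The action of the Weyl group `W` of `GL_{2n}` (permutations `w`, identified with the permutation
matrices `w e_i = e_{w i}`) on characters: `(^w χ)(t) = χ(w⁻¹ t w)` for diagonal `t`. -/
def weylAct (w : Equiv.Perm (Idx n)) (χ : Idx n → Fˣ →* ℂˣ) : Idx n → Fˣ →* ℂˣ :=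
  fun i => χ (w⁻¹ i)

/-- The involution `i ↦ 2n + 1 - i` of the indices `1, …, 2n`. -/
def revIdx (n : ℕ) : Equiv.Perm (Idx n) :=
  (Equiv.sumComm (Fin n) (Fin n)).trans (Equiv.sumCongr Fin.revPerm Fin.revPerm)

/-- The Weyl group `Γ` of `Sp_{2n}` (for the antidiagonal symplectic form) inside `W`: the
permutations which commute with `i ↦ 2n + 1 - i`. -/
def spWeyl (n : ℕ) : Subgroup (Equiv.Perm (Idx n)) := Subgroup.centralizer {revIdx n}

/-- The tuple `(χ_1, …, χ_n, χ_n⁻¹, …, χ_1⁻¹)`. -/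
def symplecticParam (χ : Fin n → Fˣ →* ℂˣ) : Idx n → Fˣ →* ℂˣ :=
  Sum.elim χ fun j => (χ j.rev)⁻¹

lemma continuous_entry (i j : Idx n) : Continuous fun g : Grp n F => g i j :=
  (Units.continuous_val (M := Matrix (Idx n) (Idx n) F)).matrix_elem i j

lemma continuous_inv_entry (i j : Idx n) :
    Continuous fun g : Grp n F => (g⁻¹ : Grp n F) i j :=
  (Units.continuous_coe_inv (M := Matrix (Idx n) (Idx n) F)).matrix_elem i j

lemma isClosed_borel : IsClosed (borelSubgroup n F : Set (Grp n F)) := by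
  have : (borelSubgroup n F : Set (Grp n F)) =
      ⋂ i, ⋂ j, ⋂ (_ : pos j < pos i), {g : Grp n F | g i j = 0} := by
    ext g; simp [borelSubgroup, IsUpper]
  rw [this]
  exact isClosed_iInter fun i => isClosed_iInter fun j => isClosed_iInter fun _ =>
    isClosed_eq (continuous_entry i j) continuous_const

instance [ProperSpace F] : LocallyCompactSpace (Matrix (Idx n) (Idx n) F) :=
  inferInstanceAs (LocallyCompactSpace (Idx n → Idx n → F))

instance [ProperSpace F] : SecondCountableTopology (Matrix (Idx n) (Idx n) F) :=
  inferInstanceAs (SecondCountableTopology (Idx n → Idx n → F))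

instance [ProperSpace F] : SecondCountableTopology (Grp n F) :=
  have : SecondCountableTopology (Matrix (Idx n) (Idx n) F)ᵐᵒᵖ :=
    MulOpposite.opHomeomorph.symm.secondCountableTopology
  (Units.isInducing_embedProduct (M := Matrix (Idx n) (Idx n) F)).secondCountableTopology

instance [ProperSpace F] : LocallyCompactSpace (borelSubgroup n F) :=
  isClosed_borel.isClosedEmbedding_subtypeVal.locallyCompactSpace

instance [ProperSpace F] : SigmaCompactSpace (borelSubgroup n F) :=
  have : SecondCountableTopology (borelSubgroup n F) :=
    Topology.IsInducing.subtypeVal.secondCountableTopology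
  sigmaCompactSpace_of_locallyCompact_secondCountable

instance : MeasurableSpace (borelSubgroup n F) := borel _

instance : BorelSpace (borelSubgroup n F) := ⟨rfl⟩

/-! ### Test functions -/

/-- The space `C_c^∞(G)` of locally constant functions with compact support. -/
def testFunctions (n : ℕ) (F : Type*) [NontriviallyNormedField F] :
    Submodule ℂ (Grp n F → ℂ) where
  carrier := {f | IsLocallyConstant f ∧ HasCompactSupport f}
  zero_mem' := ⟨IsLocallyConstant.const 0, HasCompactSupport.zero⟩
  add_mem' := fun ha hb => ⟨ha.1.add hb.1, ha.2.add hb.2⟩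
  smul_mem' := fun c _ hf => ⟨hf.1.comp (fun z => c • z), hf.2.comp_left (smul_zero c)⟩

/-- Right translation of test functions, `(R_g f)(x) = f(x g)`. -/
def testRight (g : Grp n F) (f : testFunctions n F) : testFunctions n F :=
  ⟨fun x => (f : Grp n F → ℂ) (x * g), f.2.1.comp_continuous (continuous_mul_const g),
    f.2.2.comp_homeomorph (Homeomorph.mulRight g)⟩

/-- Left translation of test functions, `x ↦ f(g⁻¹ x)`. -/
def testLeft (g : Grp n F) (f : testFunctions n F) : testFunctions n F :=
  ⟨fun x => (f : Grp n F → ℂ) (g⁻¹ * x), f.2.1.comp_continuous (continuous_const_mul g⁻¹),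
    f.2.2.comp_homeomorph (Homeomorph.mulLeft g⁻¹)⟩

lemma exists_right_invariant (f : testFunctions n F) :
    ∃ U ∈ nhds (1 : Grp n F), ∀ u ∈ U, ∀ x, (f : Grp n F → ℂ) (x * u) = (f : Grp n F → ℂ) x := by
  obtain ⟨f, hf, hc⟩ := f
  have hopen : IsOpen {q : Grp n F × Grp n F | f (q.1 * q.2) = f q.1} := by
    have h : IsLocallyConstant fun q : Grp n F × Grp n F => f (q.1 * q.2) - f q.1 :=
      (hf.comp_continuous continuous_mul).sub (hf.comp_continuous continuous_fst)
    have h2 := h.isOpen_fiber 0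
    simpa [sub_eq_zero] using h2
  obtain ⟨A, V, hA, hV, hKA, h1V, hAV⟩ := generalized_tube_lemma hc.isCompact
    (isCompact_singleton (x := (1 : Grp n F))) hopen (by
      rintro ⟨x, u⟩ ⟨_, hu⟩
      simp only [Set.mem_singleton_iff] at hu
      simp [hu])
  have hVn : V ∈ nhds (1 : Grp n F) := hV.mem_nhds (h1V rfl)
  refine ⟨V ∩ V⁻¹, Filter.inter_mem hVn (inv_mem_nhds_one _ hVn), fun u hu x => ?_⟩
  change f (x * u) = f x
  by_cases hx : x ∈ tsupport f
  · exact hAV (Set.mk_mem_prod (hKA hx) hu.1)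
  · by_cases hxu : x * u ∈ tsupport f
    · have h3 : (x * u, u⁻¹) ∈ {q : Grp n F × Grp n F | f (q.1 * q.2) = f q.1} :=
        hAV (Set.mk_mem_prod (hKA hxu) hu.2)
      change f (x * u * u⁻¹) = f (x * u) at h3
      rw [mul_inv_cancel_right] at h3
      exact h3.symm
    · rw [image_eq_zero_of_notMem_tsupport hx, image_eq_zero_of_notMem_tsupport hxu]

/-! ### The Shalika subgroup -/

/-- The element `diag(g, g) · (I X; 0 I)` of `G`. -/
def shalikaElt (g : Matrix.GeneralLinearGroup (Fin n) F) (X : Matrix (Fin n) (Fin n) F) :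
    Grp n F where
  val := Matrix.fromBlocks (g : Matrix (Fin n) (Fin n) F) 0 0 g * Matrix.fromBlocks 1 X 0 1
  inv := Matrix.fromBlocks 1 (-X) 0 1 *
    Matrix.fromBlocks ((g⁻¹ : Matrix.GeneralLinearGroup (Fin n) F) : Matrix (Fin n) (Fin n) F) 0 0
      ((g⁻¹ : Matrix.GeneralLinearGroup (Fin n) F) : Matrix (Fin n) (Fin n) F)
  val_inv := by
    simp [Matrix.fromBlocks_multiply, -Matrix.coe_units_inv, mul_assoc]
  inv_val := by
    simp [Matrix.fromBlocks_multiply, -Matrix.coe_units_inv, mul_assoc]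

lemma shalikaElt_mul (g g' : Matrix.GeneralLinearGroup (Fin n) F)
    (X X' : Matrix (Fin n) (Fin n) F) :
    shalikaElt g X * shalikaElt g' X' = shalikaElt (g * g')
      (X' + ((g'⁻¹ : Matrix.GeneralLinearGroup (Fin n) F) : Matrix (Fin n) (Fin n) F) * X * g') := by
  apply Units.ext
  simp [shalikaElt, Matrix.fromBlocks_multiply, -Matrix.coe_units_inv, mul_assoc, mul_add]

lemma shalikaElt_one : shalikaElt (1 : Matrix.GeneralLinearGroup (Fin n) F) 0 = 1 := by
  apply Units.ext
  simp [shalikaElt]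

/-- The Shalika subgroup `S` of `G`. -/
def shalikaSubgroup (n : ℕ) (F : Type*) [NontriviallyNormedField F] : Subgroup (Grp n F) where
  carrier := {s | ∃ (g : Matrix.GeneralLinearGroup (Fin n) F) (X : Matrix (Fin n) (Fin n) F),
    s = shalikaElt g X}
  one_mem' := ⟨1, 0, shalikaElt_one.symm⟩
  mul_mem' := by
    rintro _ _ ⟨g, X, rfl⟩ ⟨g', X', rfl⟩
    exact ⟨_, _, shalikaElt_mul g g' X X'⟩
  inv_mem' := by
    rintro _ ⟨g, X, rfl⟩
    refine ⟨g⁻¹, -((g : Matrix (Fin n) (Fin n) F) * X *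
      ((g⁻¹ : Matrix.GeneralLinearGroup (Fin n) F) : Matrix (Fin n) (Fin n) F)), ?_⟩
    rw [inv_eq_iff_mul_eq_one, shalikaElt_mul, ← shalikaElt_one]
    simp [-Matrix.coe_units_inv, mul_assoc]

/-- The antidiagonal permutation matrix `w_0` of size `n`. -/
def antidiag (n : ℕ) (F : Type*) [NontriviallyNormedField F] : Matrix (Fin n) (Fin n) F :=
  Matrix.of fun i j => if j = i.rev then 1 else 0

lemma antidiag_mul_self : antidiag n F * antidiag n F = 1 := by
  ext i j
  rw [Matrix.mul_apply, Finset.sum_eq_single i.rev]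
  · simp [antidiag, Matrix.one_apply, eq_comm]
  · intro k _ hk
    simp [antidiag, hk]
  · simp

/-- The matrix `ξ = (0 I; w_0 0)`. -/
def xi (n : ℕ) (F : Type*) [NontriviallyNormedField F] : Grp n F where
  val := Matrix.fromBlocks 0 1 (antidiag n F) 0
  inv := Matrix.fromBlocks 0 (antidiag n F) 1 0
  val_inv := by simp [Matrix.fromBlocks_multiply, antidiag_mul_self]
  inv_val := by simp [Matrix.fromBlocks_multiply, antidiag_mul_self]

/-- The conjugate `H = ξ S ξ⁻¹` of the Shalika subgroup. -/
def conjShalika (n : ℕ) (F : Type*) [NontriviallyNormedField F] : Subgroup (Grp n F) :=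
  (shalikaSubgroup n F).map (MulAut.conj (xi n F)).toMonoidHom

/-- The open double coset `P · H`. -/
def openOrbit (n : ℕ) (F : Type*) [NontriviallyNormedField F] : Set (Grp n F) :=
  {x | ∃ p ∈ borelSubgroup n F, ∃ h ∈ conjShalika n F, x = p * h}

/-- The additive character `ψ` has conductor the ring of integers `𝔬`: the largest `𝔬`-submodule
of `F` on which it is trivial is `𝔬`. -/
def HasConductorIntegers (ψ : AddChar F Circle) : Prop :=
  ∀ x : F, (∀ y : F, ‖y‖ ≤ 1 → ψ (x * y) = 1) ↔ ‖x‖ ≤ 1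

/-- `ϖ` is a uniformizer: it generates the maximal ideal `{x | ‖x‖ < 1}`. -/
def IsUniformizer (ϖ : Fˣ) : Prop :=
  ‖(ϖ : F)‖ < 1 ∧ ∀ x : F, ‖x‖ < 1 → ‖x‖ ≤ ‖(ϖ : F)‖

/-- The diagonal matrix with given diagonal entries. -/
def torusElt (t : Idx n → Fˣ) : Grp n F where
  val := Matrix.diagonal fun i => (t i : F)
  inv := Matrix.diagonal fun i => ((t i)⁻¹ : Fˣ)
  val_inv := by simp [-Units.val_inv_eq_inv_val]
  inv_val := by simp [-Units.val_inv_eq_inv_val]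

/-- The matrix `g_{-λ} = diag(ϖ^{-λ_1}, …, ϖ^{-λ_n}, 1, …, 1)`. -/
def gNeg (ϖ : Fˣ) (l : Fin n → ℤ) : Grp n F :=
  torusElt (Sum.elim (fun i => ϖ ^ (-l i)) fun _ => 1)

/-! ### The Iwahori subgroup -/

/-- Integral matrices whose entries below the diagonal lie in the maximal ideal. -/
def IsIwahoriIntegral (M : Matrix (Idx n) (Idx n) F) : Prop :=
  ∀ i j, ‖M i j‖ ≤ 1 ∧ (pos j < pos i → ‖M i j‖ < 1)

section Iwahori

variable [IsUltrametricDist F]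

lemma IsIwahoriIntegral.mul {A B : Matrix (Idx n) (Idx n) F} (hA : IsIwahoriIntegral A)
    (hB : IsIwahoriIntegral B) : IsIwahoriIntegral (A * B) := by
  intro i j
  rw [Matrix.mul_apply]
  constructor
  · refine IsUltrametricDist.norm_sum_le_of_forall_le_of_nonneg zero_le_one fun k _ => ?_
    rw [norm_mul]
    exact mul_le_one₀ (hA i k).1 (norm_nonneg _) (hB k j).1
  · intro hij
    obtain ⟨k, -, hk⟩ := IsUltrametricDist.exists_norm_finsetSum_le_of_nonempty
      (t := Finset.univ) ⟨i, Finset.mem_univ i⟩ (fun k => A i k * B k j)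
    refine hk.trans_lt ?_
    rw [norm_mul]
    rcases lt_or_ge (pos k) (pos i) with h | h
    · exact mul_lt_one_of_nonneg_of_lt_one_left (norm_nonneg _) ((hA i k).2 h) (hB k j).1
    · exact mul_lt_one_of_nonneg_of_lt_one_right (hA i k).1 (norm_nonneg _)
        ((hB k j).2 (hij.trans_le h))

/-- The standard Iwahori subgroup `B`: matrices in `GL_{2n}(𝔬)` which are upper triangular modulo
the maximal ideal. -/
def iwahori (n : ℕ) (F : Type*) [NontriviallyNormedField F] [IsUltrametricDist F] :
    Subgroup (Grp n F) where
  carrier := {g | IsIwahoriIntegral (g : Matrix (Idx n) (Idx n) F) ∧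
    IsIwahoriIntegral ((g⁻¹ : Grp n F) : Matrix (Idx n) (Idx n) F)}
  one_mem' := by
    have h : IsIwahoriIntegral (1 : Matrix (Idx n) (Idx n) F) := fun i j => by
      rw [Matrix.one_apply]
      split_ifs with h
      · exact ⟨by simp, fun hij => absurd hij (by rw [h]; exact lt_irrefl _)⟩
      · simp
    exact ⟨h, by simpa using h⟩
  mul_mem' := fun {a b} ha hb => ⟨ha.1.mul hb.1, by
    rw [mul_inv_rev]; exact hb.2.mul ha.2⟩
  inv_mem' := fun {a} ha => ⟨ha.2, by rw [inv_inv]; exact ha.1⟩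

lemma isOpen_iwahori : IsOpen (iwahori n F : Set (Grp n F)) := by
  have key : (iwahori n F : Set (Grp n F)) =
      (⋂ i, ⋂ j, {g : Grp n F | ‖g i j‖ ≤ 1} ∩ ⋂ (_ : pos j < pos i), {g | ‖g i j‖ < 1}) ∩
      (⋂ i, ⋂ j, {g : Grp n F | ‖(g⁻¹ : Grp n F) i j‖ ≤ 1} ∩
        ⋂ (_ : pos j < pos i), {g | ‖(g⁻¹ : Grp n F) i j‖ < 1}) := by
    ext g
    simp [-Matrix.coe_units_inv, iwahori, IsIwahoriIntegral]
  have hball : IsOpen {x : F | ‖x‖ ≤ 1} := by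
    have h := IsUltrametricDist.isOpen_closedBall (0 : F) one_ne_zero
    simpa [Metric.closedBall, dist_zero_right] using h
  have hlt : IsOpen {x : F | ‖x‖ < 1} := isOpen_lt continuous_norm continuous_const
  rw [key]
  refine IsOpen.inter ?_ ?_
  · exact isOpen_iInter_of_finite fun i => isOpen_iInter_of_finite fun j =>
      (hball.preimage (continuous_entry i j)).inter
        (isOpen_iInter_of_finite fun _ => hlt.preimage (continuous_entry i j))
  · exact isOpen_iInter_of_finite fun i => isOpen_iInter_of_finite fun j =>
      (hball.preimage (continuous_inv_entry i j)).inter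
        (isOpen_iInter_of_finite fun _ => hlt.preimage (continuous_inv_entry i j))

lemma isCompact_iwahori [ProperSpace F] : IsCompact (iwahori n F : Set (Grp n F)) := by
  have hC : IsCompact {M : Matrix (Idx n) (Idx n) F | ∀ i j, ‖M i j‖ ≤ 1} := by
    have h : IsCompact (Set.univ.pi fun _ : Idx n => Set.univ.pi fun _ : Idx n =>
        Metric.closedBall (0 : F) 1) :=
      isCompact_univ_pi fun _ => isCompact_univ_pi fun _ => isCompact_closedBall _ _
    have heq : (Set.univ.pi fun _ : Idx n => Set.univ.pi fun _ : Idx n =>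
        Metric.closedBall (0 : F) 1) = {M : Idx n → Idx n → F | ∀ i j, ‖M i j‖ ≤ 1} := by
      ext M
      simp [Set.mem_pi]
    rw [heq] at h
    exact h
  have hE : Topology.IsClosedEmbedding (Units.embedProduct (Matrix (Idx n) (Idx n) F)) :=
    Units.isClosedEmbedding_embedProduct
  have hK := hE.isCompact_preimage
    (hC.prod (hC.image MulOpposite.continuous_op))
  have hcl : IsClosed (iwahori n F : Set (Grp n F)) :=
    Subgroup.isClosed_of_isOpen _ isOpen_iwahori
  refine hK.of_isClosed_subset hcl fun g hg => ?_
  exact ⟨fun i j => (hg.1 i j).1, ⟨_, fun i j => (hg.2 i j).1, rfl⟩⟩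

/-- The characteristic function of the coset `x B`, as a test function. -/
def cosetIndicator [ProperSpace F] (x : Grp n F) : testFunctions n F :=
  ⟨fun y => (iwahori n F : Set (Grp n F)).indicator (fun _ => (1 : ℂ)) (x⁻¹ * y), by
    have hclopen : IsClopen (iwahori n F : Set (Grp n F)) :=
      ⟨Subgroup.isClosed_of_isOpen _ isOpen_iwahori, isOpen_iwahori⟩
    have h1 : IsLocallyConstant
        ((iwahori n F : Set (Grp n F)).indicator (fun _ => (1 : ℂ))) :=
      (LocallyConstant.indicator (LocallyConstant.const (Grp n F) (1 : ℂ)) hclopen).isLocallyConstant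
    have h2 : HasCompactSupport
        ((iwahori n F : Set (Grp n F)).indicator (fun _ => (1 : ℂ))) :=
      HasCompactSupport.intro isCompact_iwahori fun y hy => Set.indicator_of_notMem hy _
    exact ⟨h1.comp_continuous (continuous_const_mul x⁻¹),
      h2.comp_homeomorph (Homeomorph.mulLeft x⁻¹)⟩⟩

end Iwahori

variable [ProperSpace F]

/-- The square root `δ^{1/2}` of the modular character `δ` of `P`, the quotient of right and left
Haar measure: `∫ f(x p) dx = δ(p) ∫ f(x) dx` for left Haar measure `dx`. On diagonal matrices it is
`|a_1|^{2n-1} |a_2|^{2n-3} ⋯ |a_{2n}|^{-(2n-1)}`. -/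
def sqrtDelta (p : borelSubgroup n F) : ℂ :=
  ((Real.sqrt (Measure.modularCharacter p : ℝ) : ℝ) : ℂ)

lemma sqrtDelta_mul (p q : borelSubgroup n F) :
    sqrtDelta (p * q) = sqrtDelta p * sqrtDelta q := by
  simp [sqrtDelta, Real.sqrt_mul]

lemma sqrtDelta_ne_zero (p : borelSubgroup n F) : sqrtDelta p ≠ 0 := by
  have h : (0 : ℝ) < (Measure.modularCharacter p : ℝ) := by
    exact_mod_cast Measure.modularCharacterFun_pos p
  simpa [sqrtDelta] using (Real.sqrt_pos.2 h).ne'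

lemma sqrtDelta_sq (p : borelSubgroup n F) :
    sqrtDelta p * sqrtDelta p = ((Measure.modularCharacter p : ℝ) : ℂ) := by
  rw [sqrtDelta, ← Complex.ofReal_mul, Real.mul_self_sqrt NNReal.zero_le_coe]

/-! ### Principal series -/

/-- The space of the unramified principal series `I(χ)`: locally constant functions on `G` with
`f(p g) = χ δ^{1/2}(p) f(g)`. -/
def principalSeries (χ : Idx n → Fˣ →* ℂˣ) : Submodule ℂ (Grp n F → ℂ) where
  carrier := {f | IsLocallyConstant f ∧ ∀ (p : borelSubgroup n F) (g : Grp n F),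
    f (p * g) = borelChar χ p * sqrtDelta p * f g}
  zero_mem' := ⟨IsLocallyConstant.const 0, by simp⟩
  add_mem' := fun ha hb => ⟨ha.1.add hb.1, fun p g => by
    simp only [Pi.add_apply, ha.2 p g, hb.2 p g, mul_add]⟩
  smul_mem' := fun c f hf => ⟨hf.1.comp (fun z => c • z), fun p g => by
    simp only [Pi.smul_apply, hf.2 p g, smul_eq_mul]; ring⟩

/-- The action of `G` on `I(χ)` by right translation, `(R_g f)(x) = f(x g)`. -/
def rightTranslate {χ : Idx n → Fˣ →* ℂˣ} (g : Grp n F) :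
    principalSeries χ →ₗ[ℂ] principalSeries χ where
  toFun f := ⟨fun x => (f : Grp n F → ℂ) (x * g),
    f.2.1.comp_continuous (continuous_mul_const g),
    fun p x => by
      have h := f.2.2 p (x * g)
      rw [← mul_assoc] at h
      exact h⟩
  map_add' _ _ := rfl
  map_smul' _ _ := rfl

/-- `G`-equivariance of a linear map between principal series. -/
def IsIntertwining {χ χ' : Idx n → Fˣ →* ℂˣ}
    (T : principalSeries χ →ₗ[ℂ] principalSeries χ') : Prop :=
  ∀ (g : Grp n F) (φ : principalSeries χ), T (rightTranslate g φ) = rightTranslate g (T φ)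

/-- The projection `𝒫_χ : C_c^∞(G) → I(χ)`,
`𝒫_χ(f)(g) = ∫_P χ⁻¹ δ^{1/2}(p) f(p g) dp`, for left Haar measure on `P`. -/
def proj (χ : Idx n → Fˣ →* ℂˣ) (f : testFunctions n F) : principalSeries χ :=
  ⟨fun g => ∫ p : borelSubgroup n F,
      ((borelChar χ p)⁻¹ : ℂˣ) * sqrtDelta p * (f : Grp n F → ℂ) (p * g) ∂Measure.haar, by
    constructor
    · obtain ⟨U, hU, hf⟩ := exists_right_invariant f
      rw [IsLocallyConstant.iff_eventually_eq]
      intro x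
      have h : ∀ᶠ y in nhds x, x⁻¹ * y ∈ U := by
        have hc : Filter.Tendsto (fun y => x⁻¹ * y) (nhds x) (nhds 1) := by
          simpa using (continuous_const_mul x⁻¹).tendsto x
        exact hc hU
      filter_upwards [h] with y hy
      refine integral_congr_ae (Filter.Eventually.of_forall fun p => ?_)
      have h2 := hf _ hy (p * x)
      rw [mul_assoc, mul_inv_cancel_left] at h2
      simp only [h2]
    · intro q g
      have hmap := Measure.map_right_mul_eq_modularCharacterFun_smul
        (Measure.haar : Measure (borelSubgroup n F)) q
      set Φ : borelSubgroup n F → ℂ := fun p =>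
        ((borelChar χ p)⁻¹ : ℂˣ) * sqrtDelta p * (f : Grp n F → ℂ) (p * g) with hΦ
      have h1 : ∫ p, Φ (p * q) ∂Measure.haar =
          ((Measure.modularCharacter q : ℝ) : ℂ) * ∫ p, Φ p ∂Measure.haar := by
        have h := (Homeomorph.mulRight q).measurableEmbedding.integral_map
          (μ := (Measure.haar : Measure (borelSubgroup n F))) Φ
        have h' : ∫ p, Φ p ∂(Measure.map (· * q) Measure.haar) =
          ∫ p, Φ (p * q) ∂Measure.haar := h
        rw [← h', hmap, integral_smul_nnreal_measure, NNReal.smul_def, Complex.real_smul]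
        rfl
      have h2 : ∀ p : borelSubgroup n F,
          ((borelChar χ p)⁻¹ : ℂˣ) * sqrtDelta p * (f : Grp n F → ℂ) (p * (q * g)) =
            (borelChar χ q * (sqrtDelta q)⁻¹) * Φ (p * q) := by
        intro p
        have hq := sqrtDelta_ne_zero q
        simp only [hΦ, map_mul, mul_inv_rev, Units.val_mul, sqrtDelta_mul, Subgroup.coe_mul,
          mul_assoc]
        have hc : (borelChar χ q : ℂ) * (((borelChar χ q)⁻¹ : ℂˣ) : ℂ) = 1 := by simp
        linear_combination (((borelChar χ p)⁻¹ : ℂˣ) * sqrtDelta p *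
          (f : Grp n F → ℂ) (p * (q * g))) *
          (-hc - (borelChar χ q : ℂ) * (((borelChar χ q)⁻¹ : ℂˣ) : ℂ) * inv_mul_cancel₀ hq)
      simp only [h2]
      rw [integral_const_mul, h1, ← sqrtDelta_sq]
      have hq := sqrtDelta_ne_zero q
      change _ = _ * ∫ p, Φ p ∂Measure.haar
      field_simp⟩

/-! ### Shalika functionals and the associated distributions -/

/-- A Shalika functional on `I(χ)`: `Λ(R_s φ) = Ψ(s) Λ(φ)` for `s = diag(g, g) (I X; 0 I)` in `S`,
where `Ψ(s) = ψ(tr X)`. -/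
def IsShalikaFunctional (ψ : AddChar F Circle) {χ : Idx n → Fˣ →* ℂˣ}
    (Λ : principalSeries χ →ₗ[ℂ] ℂ) : Prop :=
  ∀ (g : Matrix.GeneralLinearGroup (Fin n) F) (X : Matrix (Fin n) (Fin n) F)
    (φ : principalSeries χ),
    Λ (rightTranslate (shalikaElt g X) φ) = (ψ X.trace : ℂ) * Λ φ

/-- The functional `Λ_H` attached to the Shalika functional `Λ`: if `f_φ(g) = Λ(R_g φ)`, then
`Λ_H(φ)` is the value at `1` of `g ↦ f_φ(ξ⁻¹ g)`. -/
def functionalH {χ : Idx n → Fˣ →* ℂˣ} (Λ : principalSeries χ →ₗ[ℂ] ℂ) :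
    principalSeries χ →ₗ[ℂ] ℂ :=
  Λ ∘ₗ rightTranslate (xi n F)⁻¹

/-- The distribution `f ↦ L(𝒫_χ f)` on `G` attached to a functional `L` on `I(χ)`. -/
def toDistribution {χ : Idx n → Fˣ →* ℂˣ} (L : principalSeries χ →ₗ[ℂ] ℂ) :
    testFunctions n F → ℂ :=
  fun f => L (proj χ f)

/-- The distribution `Δ_H` attached to `Λ_H`. -/
def deltaH {χ : Idx n → Fˣ →* ℂˣ} (Λ : principalSeries χ →ₗ[ℂ] ℂ) : testFunctions n F → ℂ :=
  toDistribution (functionalH Λ)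

/-- The distribution `T^* Δ_H`, attached to the functional `Λ_H ∘ T`, for a linear map
`T : I(χ') → I(χ)`. -/
def pullbackDeltaH {χ χ' : Idx n → Fˣ →* ℂˣ} (T : principalSeries χ' →ₗ[ℂ] principalSeries χ)
    (Λ : principalSeries χ →ₗ[ℂ] ℂ) : testFunctions n F → ℂ :=
  toDistribution (functionalH Λ ∘ₗ T)

/-- A distribution is supported away from the open set `U` if it vanishes on all test functions
which are supported in `U`. -/
def SupportedAwayFrom (D : testFunctions n F → ℂ) (U : Set (Grp n F)) : Prop :=
  ∀ f : testFunctions n F, Function.support (f : Grp n F → ℂ) ⊆ U → D f = 0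

/-- The relation `D(p g) = χ⁻¹ δ^{1/2}(p) D(g)` for a distribution `D`, in terms of its values
on test functions. -/
def IsLeftEquivariant (χ : Idx n → Fˣ →* ℂˣ) (D : testFunctions n F → ℂ) : Prop :=
  ∀ (p : borelSubgroup n F) (f : testFunctions n F),
    D (testLeft (p : Grp n F) f) = ((borelChar χ p)⁻¹ : ℂˣ) * sqrtDelta p * D f

lemma toDistribution_leftEquivariant {χ : Idx n → Fˣ →* ℂˣ} (L : principalSeries χ →ₗ[ℂ] ℂ) :
    IsLeftEquivariant χ (toDistribution L) := by
  intro p f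
  have h : proj χ (testLeft (p : Grp n F) f) =
      (((borelChar χ p)⁻¹ : ℂˣ) * sqrtDelta p : ℂ) • proj χ f := by
    apply Subtype.ext
    funext g
    change ∫ q : borelSubgroup n F, ((borelChar χ q)⁻¹ : ℂˣ) * sqrtDelta q *
        (f : Grp n F → ℂ) ((p : Grp n F)⁻¹ * (q * g)) ∂Measure.haar =
      (((borelChar χ p)⁻¹ : ℂˣ) * sqrtDelta p : ℂ) * ∫ q : borelSubgroup n F,
        ((borelChar χ q)⁻¹ : ℂˣ) * sqrtDelta q * (f : Grp n F → ℂ) (q * g) ∂Measure.haar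
    rw [← integral_const_mul, ← integral_mul_left_eq_self _ p]
    refine integral_congr_ae (Filter.Eventually.of_forall fun q => ?_)
    simp only [map_mul, mul_inv_rev, Units.val_mul, sqrtDelta_mul, Subgroup.coe_mul, mul_assoc,
      inv_mul_cancel_left]
    ring
  simp only [toDistribution, h, map_smul, smul_eq_mul]

/-- The translate `R_g^* D` of a distribution, that is `D ∘ R_g`. Since `R_g^* = R_{g⁻¹}`, this is
the distribution `(R_{g⁻¹} D)(x) = D(x g⁻¹)`. -/
def translateDist (g : Grp n F) (D : testFunctions n F → ℂ) : testFunctions n F → ℂ :=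
  fun f => D (testRight g f)

lemma IsLeftEquivariant.translate {χ : Idx n → Fˣ →* ℂˣ} {D : testFunctions n F → ℂ}
    (hD : IsLeftEquivariant χ D) (g : Grp n F) : IsLeftEquivariant χ (translateDist g D) := by
  intro p f
  have h : testRight g (testLeft (p : Grp n F) f) = testLeft (p : Grp n F) (testRight g f) := by
    apply Subtype.ext
    funext x
    simp [testRight, testLeft, mul_assoc]
  simp only [translateDist, h, hD p]

/-! ### Iwahori invariants and Casselman coefficients -/

variable [IsUltrametricDist F]

/-- The space `I(χ)^B` of Iwahori-invariant vectors. -/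
def iwahoriInvariants (χ : Idx n → Fˣ →* ℂˣ) : Submodule ℂ (principalSeries χ) where
  carrier := {φ | ∀ b ∈ iwahori n F, rightTranslate b φ = φ}
  zero_mem' := fun b _ => map_zero _
  add_mem' := fun ha hb b hb' => by rw [map_add, ha b hb', hb b hb']
  smul_mem' := fun c φ hφ b hb => by rw [map_smul, hφ b hb]

/-- The projection `R_B D(g) = ∫_B D(g b) db = ∫_G D(b) 1_B(g⁻¹ b) db` of a distribution `D` with
`D(p g) = χ⁻¹ δ^{1/2}(p) D(g)` to `I(χ⁻¹)^B`. -/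
def iwahoriProj (χ : Idx n → Fˣ →* ℂˣ) (D : testFunctions n F → ℂ)
    (hD : IsLeftEquivariant χ D) : iwahoriInvariants (n := n) χ⁻¹ :=
  have hB : ∀ x, ∀ b ∈ iwahori n F, cosetIndicator (x * b) = cosetIndicator x := by
    intro x b hb
    apply Subtype.ext
    funext y
    simp only [cosetIndicator, mul_inv_rev, mul_assoc]
    have hiff : b⁻¹ * (x⁻¹ * y) ∈ (iwahori n F : Set (Grp n F)) ↔
        x⁻¹ * y ∈ (iwahori n F : Set (Grp n F)) :=
      Subgroup.mul_mem_cancel_left _ (inv_mem hb)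
    by_cases h : x⁻¹ * y ∈ (iwahori n F : Set (Grp n F))
    · rw [Set.indicator_of_mem h, Set.indicator_of_mem (hiff.2 h)]
    · rw [Set.indicator_of_notMem h, Set.indicator_of_notMem fun h' => h (hiff.1 h')]
  ⟨⟨fun x => D (cosetIndicator x), by
      constructor
      · rw [IsLocallyConstant.iff_eventually_eq]
        intro x
        have h : ∀ᶠ y in nhds x, x⁻¹ * y ∈ iwahori n F := by
          have hc : Filter.Tendsto (fun y => x⁻¹ * y) (nhds x) (nhds 1) := by
            simpa using (continuous_const_mul x⁻¹).tendsto x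
          exact hc (isOpen_iwahori.mem_nhds (one_mem _))
        filter_upwards [h] with y hy
        have h2 := hB x _ hy
        rw [mul_inv_cancel_left] at h2
        rw [h2]
      · intro p x
        have h : cosetIndicator ((p : Grp n F) * x) =
            testLeft (p : Grp n F) (cosetIndicator x) := by
          apply Subtype.ext
          funext y
          simp [cosetIndicator, testLeft, mul_assoc]
        change D (cosetIndicator ((p : Grp n F) * x)) = _
        rw [h, hD p]
        congr 2
        simp [borelChar]⟩, by
    intro b hb
    apply Subtype.ext
    funext x
    exact congrArg D (hB x b hb)⟩

/-- The element `R_B R_{g⁻¹} Δ_H` of `I(χ⁻¹)^B`. -/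
def projDeltaH {χ : Idx n → Fˣ →* ℂˣ} (Λ : principalSeries χ →ₗ[ℂ] ℂ) (g : Grp n F) :
    iwahoriInvariants (n := n) χ⁻¹ :=
  iwahoriProj χ (translateDist g (deltaH Λ))
    ((toDistribution_leftEquivariant (functionalH Λ)).translate g)

/-- `f` is the Casselman basis of `I(χ)^B` for the intertwining operators
`T_w : I(χ) → I(^w χ)`: the basis dual to the functionals `φ ↦ T_w(φ)(1)`. -/
def IsCasselmanBasis {χ : Idx n → Fˣ →* ℂˣ}
    (T : ∀ w : Equiv.Perm (Idx n), principalSeries χ →ₗ[ℂ] principalSeries (weylAct w χ))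
    (f : Module.Basis (Equiv.Perm (Idx n)) ℂ (iwahoriInvariants (n := n) χ)) : Prop :=
  ∀ w w' : Equiv.Perm (Idx n),
    (T w (f w' : principalSeries χ) : Grp n F → ℂ) 1 = if w = w' then 1 else 0

/-- The Casselman coefficients `a_w(g)`, defined by `R_B R_{g⁻¹} Δ_H = ∑_w a_w(g) f_w`. -/
def casselmanCoeff {χ : Idx n → Fˣ →* ℂˣ}
    (f : Module.Basis (Equiv.Perm (Idx n)) ℂ (iwahoriInvariants (n := n) χ⁻¹))
    (Λ : principalSeries χ →ₗ[ℂ] ℂ) (g : Grp n F) (w : Equiv.Perm (Idx n)) : ℂ :=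
  f.repr (projDeltaH Λ g) w

end Shalika

end

/-! Both halves come from one vanishing statement, `supportedAwayFrom_openOrbit_of_notMem_spWeyl`.
Let `D` be a distribution on `G` that transforms on the left under `P` by `η⁻¹ δ^{1/2}`, with `η` a
Weyl translate of the symplectic parameter, and on the right under `H` by the Shalika character. On
the open orbit `P · H`, which is homogeneous under `P × H`, such a `D` can be nonzero only if its
character is compatible with the stabilizer of `1`. That stabilizer is `P ∩ H` embedded diagonally,
and `P ∩ H` consists of diagonal matrices whose entries agree at `i` and `2n + 1 - i`. There the
Shalika character and `δ^{1/2}` are trivial, and so is the modular correction of the homogeneous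
space, so `η` itself must be trivial: `η_i η_{2n+1-i} = 1` for all `i`. For generic `χ` this forces
`w ∈ Γ`.

The two modular trivialities have a common source, the involution `θ(g) = w g⁻ᵀ w`. It preserves
`P`, `H` and all congruence subgroups, and inverts every element `a` of `P ∩ H`; hence a modular
quantity at `a` equals the one at `a⁻¹`.

No invariant measure on the orbit is used. For a compact open subgroup `W` of `P × H` fixing `D`,
the indicator of `W · 1` is compared with that of `W' · 1`, `W' ≤ W`, by summing translates over `W
/ W'` (`exists_card_mul_orbitTest`). Applied to `W`, its conjugate by `(a, a)` and their
intersection, this gives `D(1_W) = z D(1_W)`, where `z ≠ 1` is the character value at `(a, a)`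
(`apply_orbitTest_pairCongruence`). Every test function supported in `P · H` is a finite combination
of indicators of small orbits, so `D` vanishes on it.

Part (1) is the case `D = Λ_H ∘ T ∘ 𝒫`. For part (2), duality makes `a_w(g)` the value at `1` of
`T_w(R_B R_{g⁻¹} Δ_H)`. As a function of the test function this is again a distribution of the above
type (`intertwinedDist`), evaluated at the indicator of `B g⁻¹`. For dominant `g` an Iwahori-type
factorization places `B g⁻¹` inside `P · H` (`iwahori_mul_inv_mem_openOrbit`). -/

noncomputable section

namespace Shalika

/-! ### Ultrametric estimates and factorization by successive approximation -/

section CongruenceSubgroups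

variable {F : Type*} [NontriviallyNormedField F] {n : ℕ}

/-! ### Entrywise bounds on matrices -/

/-- All entries of `M` have norm at most `r`. -/
def EntryBound {ι : Type*} (M : Matrix ι ι F) (r : ℝ) : Prop := ∀ i j, ‖M i j‖ ≤ r

section EntryBound

variable {ι : Type*}

lemma EntryBound.mono {A : Matrix ι ι F} {a b : ℝ} (hA : EntryBound A a) (h : a ≤ b) :
    EntryBound A b := fun i j => (hA i j).trans h

lemma EntryBound.neg {A : Matrix ι ι F} {a : ℝ} (hA : EntryBound A a) : EntryBound (-A) a :=
  fun i j => by simpa using hA i j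

lemma entryBound_one [DecidableEq ι] : EntryBound (1 : Matrix ι ι F) 1 := by
  intro i j
  rw [Matrix.one_apply]
  split_ifs <;> simp

variable [IsUltrametricDist F]

lemma EntryBound.add {A B : Matrix ι ι F} {a : ℝ} (hA : EntryBound A a) (hB : EntryBound B a) :
    EntryBound (A + B) a := fun i j =>
  (IsUltrametricDist.norm_add_le_max _ _).trans (max_le (hA i j) (hB i j))

lemma EntryBound.of_sub_one [DecidableEq ι] {A : Matrix ι ι F} {a : ℝ} (hA : EntryBound (A - 1) a)
    (ha : a ≤ 1) : EntryBound A 1 := by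
  have h := (hA.mono ha).add entryBound_one
  rwa [sub_add_cancel] at h

variable [Fintype ι]

lemma EntryBound.mul {A B : Matrix ι ι F} {a b : ℝ} (hA : EntryBound A a) (hB : EntryBound B b)
    (ha : 0 ≤ a) (hb : 0 ≤ b) : EntryBound (A * B) (a * b) := by
  intro i j
  rw [Matrix.mul_apply]
  refine IsUltrametricDist.norm_sum_le_of_forall_le_of_nonneg (mul_nonneg ha hb) fun k _ => ?_
  rw [norm_mul]
  exact mul_le_mul (hA i k) (hB k j) (norm_nonneg _) ha

variable [DecidableEq ι]

/-- A matrix whose entries are close to those of the identity is invertible. -/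
lemma EntryBound.isUnit {A : Matrix ι ι F} {a : ℝ} (hA : EntryBound (A - 1) a) (ha : a < 1) :
    IsUnit A := by
  rw [Matrix.isUnit_iff_isUnit_det, isUnit_iff_ne_zero]
  intro h0
  obtain ⟨v, hv, hAv⟩ := Matrix.exists_mulVec_eq_zero_iff.2 h0
  obtain ⟨i0, hi0⟩ := Function.ne_iff.1 hv
  have : Nonempty ι := ⟨i0⟩
  -- A kernel vector satisfies `v = -(A - 1) v`, so its largest coordinate would be bounded by `a <
  -- 1` times itself.
  obtain ⟨i, hi⟩ := Finite.exists_max fun i => ‖v i‖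
  have hpos : 0 < ‖v i‖ := (norm_pos_iff.2 hi0).trans_le (hi i0)
  have ha0 : 0 ≤ a := (norm_nonneg _).trans (hA i i)
  have h1 : v i = -((A - 1).mulVec v) i := by
    rw [Matrix.sub_mulVec, hAv, Matrix.one_mulVec]; simp
  have h2 : ‖v i‖ ≤ a * ‖v i‖ := by
    conv_lhs => rw [h1, norm_neg]
    refine IsUltrametricDist.norm_sum_le_of_forall_le_of_nonneg
      (mul_nonneg ha0 (norm_nonneg _)) fun k _ => ?_
    rw [norm_mul]
    exact mul_le_mul (hA i k) (hi k) (norm_nonneg _) ha0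
  nlinarith

/-- From `N = 1 - (A - 1) N`, the largest entry in each column of `N` cannot exceed `1`; feeding
this back into the same identity bounds `N - 1` by `a`, with no loss. -/
lemma EntryBound.of_mul_eq_one {A N : Matrix ι ι F} {a : ℝ} (hA : EntryBound (A - 1) a)
    (ha : a < 1) (h : A * N = 1) : EntryBound (N - 1) a := by
  have hN : EntryBound N 1 := by
    rcases isEmpty_or_nonempty ι with hι | hι
    · exact fun i => hι.elim i
    intro i0 j
    have ha0 : 0 ≤ a := (norm_nonneg _).trans (hA i0 i0)
    obtain ⟨i, hi⟩ := Finite.exists_max fun i => ‖N i j‖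
    refine (hi i0).trans ?_
    by_contra! hgt
    have h1 : N i j = (1 : Matrix ι ι F) i j - ((A - 1) * N) i j := by
      rw [Matrix.sub_mul, h, Matrix.one_mul]; simp
    have h2 : ‖((A - 1) * N) i j‖ ≤ a * ‖N i j‖ := by
      rw [Matrix.mul_apply]
      refine IsUltrametricDist.norm_sum_le_of_forall_le_of_nonneg
        (mul_nonneg ha0 (norm_nonneg _)) fun k _ => ?_
      rw [norm_mul]
      exact mul_le_mul (hA i k) (hi k) (norm_nonneg _) ha0
    have h3 : ‖N i j‖ ≤ max 1 (a * ‖N i j‖) := by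
      conv_lhs => rw [h1, sub_eq_add_neg]
      refine (IsUltrametricDist.norm_add_le_max _ _).trans (max_le_max (entryBound_one i j) ?_)
      rwa [norm_neg]
    rcases le_max_iff.1 h3 with h4 | h4 <;> nlinarith
  have h1 : N - 1 = -((A - 1) * N) := by
    rw [Matrix.sub_mul, h, Matrix.one_mul]; abel
  intro i j
  have ha0 : 0 ≤ a := (norm_nonneg _).trans (hA i i)
  have h2 := (hA.mul hN ha0 zero_le_one).neg i j
  rwa [← h1, mul_one] at h2

end EntryBound

/-! ### Congruence subgroups -/

section Congruence

variable [IsUltrametricDist F]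

/-- The congruence subgroup of matrices whose entries differ from those of the identity by at
most `ε < 1`. -/
def congruenceSubgroup (n : ℕ) (F : Type*) [NontriviallyNormedField F] [IsUltrametricDist F]
    (ε : Set.Ioo (0 : ℝ) 1) : Subgroup (Grp n F) where
  carrier := {g | EntryBound ((g : Matrix (Idx n) (Idx n) F) - 1) ε}
  one_mem' := fun i j => by simpa using ε.2.1.le
  mul_mem' := by
    intro g h hg hh
    have h1 : ((g * h : Grp n F) : Matrix (Idx n) (Idx n) F) - 1 =
        ((g : Matrix (Idx n) (Idx n) F) - 1) * h + ((h : Matrix (Idx n) (Idx n) F) - 1) := by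
      rw [Units.val_mul]; noncomm_ring
    have h2 := EntryBound.mul hg (EntryBound.of_sub_one hh ε.2.2.le) ε.2.1.le zero_le_one
    rw [mul_one] at h2
    change EntryBound _ _
    rw [h1]
    exact h2.add hh
  inv_mem' := fun {g} hg => EntryBound.of_mul_eq_one hg ε.2.2 g.mul_inv

lemma mem_congruenceSubgroup {ε : Set.Ioo (0 : ℝ) 1} {g : Grp n F} :
    g ∈ congruenceSubgroup n F ε ↔ EntryBound ((g : Matrix (Idx n) (Idx n) F) - 1) ε := Iff.rfl

lemma congruenceSubgroup_mono {ε δ : Set.Ioo (0 : ℝ) 1} (h : ε ≤ δ) :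
    congruenceSubgroup n F ε ≤ congruenceSubgroup n F δ := fun _ hg => EntryBound.mono hg h

lemma isOpen_congruenceSubgroup (ε : Set.Ioo (0 : ℝ) 1) :
    IsOpen (congruenceSubgroup n F ε : Set (Grp n F)) := by
  have key : (congruenceSubgroup n F ε : Set (Grp n F)) =
      ⋂ i, ⋂ j, {g : Grp n F | ‖g i j - (1 : Matrix (Idx n) (Idx n) F) i j‖ ≤ ε} := by
    ext g
    simp [mem_congruenceSubgroup, EntryBound]
  have hball : IsOpen {x : F | ‖x‖ ≤ ε} := by
    have h := IsUltrametricDist.isOpen_closedBall (0 : F) ε.2.1.ne'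
    simpa [Metric.closedBall, dist_zero_right] using h
  rw [key]
  exact isOpen_iInter_of_finite fun i => isOpen_iInter_of_finite fun j =>
    hball.preimage ((continuous_entry i j).sub continuous_const)

lemma isClosed_congruenceSubgroup (ε : Set.Ioo (0 : ℝ) 1) :
    IsClosed (congruenceSubgroup n F ε : Set (Grp n F)) :=
  Subgroup.isClosed_of_isOpen _ (isOpen_congruenceSubgroup ε)

lemma congruenceSubgroup_le_iwahori (ε : Set.Ioo (0 : ℝ) 1) :
    congruenceSubgroup n F ε ≤ iwahori n F := by
  have key : ∀ g ∈ congruenceSubgroup n F ε,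
      IsIwahoriIntegral (g : Matrix (Idx n) (Idx n) F) := by
    intro g hg i j
    refine ⟨EntryBound.of_sub_one hg ε.2.2.le i j, fun hij => ?_⟩
    have h := hg i j
    have hne : i ≠ j := fun h => absurd hij (by rw [h]; exact lt_irrefl _)
    rw [Matrix.sub_apply, Matrix.one_apply_ne hne, sub_zero] at h
    exact h.trans_lt ε.2.2
  exact fun g hg => ⟨key g hg, key _ (inv_mem hg)⟩

lemma isCompact_congruenceSubgroup [ProperSpace F] (ε : Set.Ioo (0 : ℝ) 1) :
    IsCompact (congruenceSubgroup n F ε : Set (Grp n F)) :=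
  isCompact_iwahori.of_isClosed_subset (isClosed_congruenceSubgroup ε)
    (congruenceSubgroup_le_iwahori ε)

instance : Nonempty (Set.Ioo (0 : ℝ) 1) := ⟨⟨1 / 2, by norm_num, by norm_num⟩⟩

/-- A directed family of compact sets with intersection `{1}` is eventually inside any neighbourhood
of `1`. -/
lemma exists_congruenceSubgroup_subset [ProperSpace F] {U : Set (Grp n F)}
    (hU : U ∈ nhds (1 : Grp n F)) :
    ∃ ε, (congruenceSubgroup n F ε : Set (Grp n F)) ⊆ U := by
  have hdir : Directed (· ⊇ ·) fun ε => (congruenceSubgroup n F ε : Set (Grp n F)) :=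
    fun ε δ => ⟨min ε δ, congruenceSubgroup_mono (min_le_left _ _),
      congruenceSubgroup_mono (min_le_right _ _)⟩
  refine exists_subset_nhds_of_isCompact' hdir isCompact_congruenceSubgroup
    isClosed_congruenceSubgroup ?_
  intro g hg
  have h1 : g = 1 := by
    apply Units.ext
    ext i j
    rw [Set.mem_iInter] at hg
    have h : ‖(g i j : F) - (1 : Matrix (Idx n) (Idx n) F) i j‖ ≤ 0 := by
      refine le_of_forall_gt_imp_ge_of_dense fun r hr => ?_
      -- The minimum with `1 / 2` only keeps the radius inside the interval `(0, 1)`.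
      have h2 := hg ⟨min r (1 / 2), lt_min hr (by norm_num), (min_le_right _ _).trans_lt
        (by norm_num)⟩ i j
      exact h2.trans (min_le_left _ _)
    rw [Units.val_one, ← sub_eq_zero]
    exact norm_le_zero_iff.1 h
  rw [h1]
  exact hU

/-- If near the identity every matrix splits, additively and without loss of size, into parts
coming from two closed subgroups `P` and `Q`, then congruence subgroups factor through them. -/
lemma congruenceSubgroup_factor [ProperSpace F] {P Q : Subgroup (Grp n F)}
    (hP : IsClosed (P : Set (Grp n F))) (hQ : IsClosed (Q : Set (Grp n F)))
    (split : ∀ (E : Matrix (Idx n) (Idx n) F) (r : ℝ), 0 ≤ r → r < 1 → EntryBound E r →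
      ∃ p ∈ P, ∃ q ∈ Q, EntryBound ((p : Matrix (Idx n) (Idx n) F) - 1) r ∧
        EntryBound ((q : Matrix (Idx n) (Idx n) F) - 1) r ∧
        E = ((p : Matrix (Idx n) (Idx n) F) - 1) + ((q : Matrix (Idx n) (Idx n) F) - 1))
    {ε : Set.Ioo (0 : ℝ) 1} {k : Grp n F} (hk : k ∈ congruenceSubgroup n F ε) :
    ∃ p ∈ P ⊓ congruenceSubgroup n F ε, ∃ q ∈ Q ⊓ congruenceSubgroup n F ε, k = p * q := by
  have hε0 : (0 : ℝ) < ε := ε.2.1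
  have hε1 : (ε : ℝ) < 1 := ε.2.2
  -- `C m` is the set of pairs `(p, q)` with `p⁻¹ k q⁻¹` within `ε^(m+1)` of the identity. These
  -- sets are compact, decreasing and nonempty, and a point of their intersection is an exact
  -- factorization.
  let C : ℕ → Set (Grp n F × Grp n F) := fun m =>
    ((P ⊓ congruenceSubgroup n F ε : Subgroup (Grp n F)) : Set (Grp n F)) ×ˢ
      ((Q ⊓ congruenceSubgroup n F ε : Subgroup (Grp n F)) : Set (Grp n F)) ∩
    {x | EntryBound (((x.1⁻¹ * k * x.2⁻¹ : Grp n F) : Matrix (Idx n) (Idx n) F) - 1)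
      ((ε : ℝ) ^ (m + 1))}
  have hcl : ∀ m, IsClosed {x : Grp n F × Grp n F |
      EntryBound (((x.1⁻¹ * k * x.2⁻¹ : Grp n F) : Matrix (Idx n) (Idx n) F) - 1)
      ((ε : ℝ) ^ (m + 1))} := by
    intro m
    simp only [EntryBound, Set.ofPred_forall]
    refine isClosed_iInter fun i => isClosed_iInter fun j => isClosed_le (Continuous.norm ?_)
      continuous_const
    have h : Continuous fun x : Grp n F × Grp n F => (x.1⁻¹ * k * x.2⁻¹ : Grp n F) := by fun_prop
    exact ((continuous_entry i j).comp h).sub continuous_const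
  have hPQ : ∀ R : Subgroup (Grp n F), IsClosed (R : Set (Grp n F)) →
      IsCompact ((R ⊓ congruenceSubgroup n F ε : Subgroup (Grp n F)) : Set (Grp n F)) := by
    intro R hR
    exact (isCompact_congruenceSubgroup ε).inter_left hR
  have hne : (⋂ m, C m).Nonempty := by
    refine IsCompact.nonempty_iInter_of_sequence_nonempty_isCompact_isClosed C ?_ ?_ ?_ ?_
    · rintro m x ⟨hx, hx2⟩
      exact ⟨hx, EntryBound.mono hx2 (pow_le_pow_of_le_one hε0.le hε1.le (by omega))⟩
    · intro m
      induction m with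
      | zero => exact ⟨(1, 1), ⟨one_mem _, one_mem _⟩,
          by simpa [mem_congruenceSubgroup] using hk⟩
      | succ m ih =>
        obtain ⟨⟨p, q⟩, ⟨hp, hq⟩, hE⟩ := ih
        have hr1 : (ε : ℝ) ^ (m + 1) ≤ ε := by
          simpa using pow_le_pow_of_le_one hε0.le hε1.le (show 1 ≤ m + 1 by omega)
        have hr0 : (0 : ℝ) ≤ (ε : ℝ) ^ (m + 1) := by positivity
        -- Newton step: the remaining error is split additively and the two parts are absorbed into
        -- `p` and `q`.
        obtain ⟨p', hp', q', hq', hEp, hEq, hsum⟩ := split _ _ hr0 (hr1.trans_lt hε1) hE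
        have hp'K : p' ∈ congruenceSubgroup n F ε := hEp.mono hr1
        have hq'K : q' ∈ congruenceSubgroup n F ε := hEq.mono hr1
        refine ⟨(p * p', q' * q), ⟨mul_mem hp ⟨hp', hp'K⟩, mul_mem ⟨hq', hq'K⟩ hq⟩, ?_⟩
        change EntryBound ((((p * p')⁻¹ * k * (q' * q)⁻¹ : Grp n F) :
          Matrix (Idx n) (Idx n) F) - 1) _
        change ((p⁻¹ * k * q⁻¹ : Grp n F) : Matrix (Idx n) (Idx n) F) - 1 = _ at hsum
        have h1 : (p * p')⁻¹ * k * (q' * q)⁻¹ = p'⁻¹ * (p⁻¹ * k * q⁻¹) * q'⁻¹ := by group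
        generalize p⁻¹ * k * q⁻¹ = k' at h1 hsum
        -- Since `k' = p' + q' - 1 = p' q' - (p' - 1)(q' - 1)`, the new error is quadratic in the
        -- old one.
        have h2 : ((p'⁻¹ * k' * q'⁻¹ : Grp n F) : Matrix (Idx n) (Idx n) F) - 1 =
            -(((p'⁻¹ : Grp n F) : Matrix (Idx n) (Idx n) F) *
              (((p' : Matrix (Idx n) (Idx n) F) - 1) * ((q' : Matrix (Idx n) (Idx n) F) - 1)) *
              ((q'⁻¹ : Grp n F) : Matrix (Idx n) (Idx n) F)) := by
          have h3 : (1 : Matrix (Idx n) (Idx n) F) =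
              ((p'⁻¹ : Grp n F) : Matrix (Idx n) (Idx n) F) * ((p' : Matrix (Idx n) (Idx n) F) * q') *
              ((q'⁻¹ : Grp n F) : Matrix (Idx n) (Idx n) F) := by
            rw [← Units.val_mul, ← Units.val_mul, ← Units.val_mul]
            simp
          rw [sub_eq_iff_eq_add] at hsum
          rw [Units.val_mul, Units.val_mul, hsum]
          refine (congrArg (fun M => _ - M) h3).trans ?_
          noncomm_ring
        rw [h1, h2]
        refine EntryBound.neg (EntryBound.mono (((EntryBound.of_sub_one (inv_mem hp'K) hε1.le).mul
          (hEp.mul hEq hr0 hr0) zero_le_one (by positivity)).mul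
          (EntryBound.of_sub_one (inv_mem hq'K) hε1.le) (by positivity) zero_le_one) ?_)
        rw [one_mul, mul_one, ← pow_add]
        -- The squared error `ε^(2(m+1))` is at most the required `ε^(m+2)`.
        exact pow_le_pow_of_le_one hε0.le hε1.le (by omega)
    · exact ((hPQ P hP).prod (hPQ Q hQ)).inter_right (hcl 0)
    · intro m
      exact (((hPQ P hP).prod (hPQ Q hQ)).isClosed).inter (hcl m)
  obtain ⟨⟨p, q⟩, hpq⟩ := hne
  rw [Set.mem_iInter] at hpq
  refine ⟨p, (hpq 0).1.1, q, (hpq 0).1.2, ?_⟩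
  have h1 : (p⁻¹ * k * q⁻¹ : Grp n F) = 1 := by
    apply Units.ext
    ext i j
    have h : ‖((p⁻¹ * k * q⁻¹ : Grp n F) i j : F) - (1 : Matrix (Idx n) (Idx n) F) i j‖ ≤ 0 :=
      ge_of_tendsto' ((tendsto_pow_atTop_nhds_zero_of_lt_one hε0.le hε1).comp
        (Filter.tendsto_add_atTop_nat 1)) fun m => (hpq m).2 i j
    rw [Units.val_one, ← sub_eq_zero]
    exact norm_le_zero_iff.1 h
  rw [mul_inv_eq_one, inv_mul_eq_iff_eq_mul] at h1
  exact h1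

end Congruence

end CongruenceSubgroups

/-! ### Matrix description of `H`, the involution `θ`, and the stabilizer `P ∩ H` -/

section SubgroupH

variable {F : Type*} [NontriviallyNormedField F] {n : ℕ}

/-! ### The subgroup `H` -/

lemma antidiag_mul_apply (M : Matrix (Fin n) (Fin n) F) (i j : Fin n) :
    (antidiag n F * M) i j = M i.rev j := by
  rw [Matrix.mul_apply, Finset.sum_eq_single i.rev]
  · simp [antidiag]
  · intro k _ hk
    simp [antidiag, hk]
  · simp

lemma mul_antidiag_apply (M : Matrix (Fin n) (Fin n) F) (i j : Fin n) :
    (M * antidiag n F) i j = M i j.rev := by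
  rw [Matrix.mul_apply, Finset.sum_eq_single j.rev]
  · simp [antidiag]
  · intro k _ hk
    have : j ≠ k.rev := fun h => hk (by rw [h, Fin.rev_rev])
    simp [antidiag, this]
  · simp

lemma coe_xi_conj (g : Matrix.GeneralLinearGroup (Fin n) F) (X : Matrix (Fin n) (Fin n) F) :
    ((xi n F * shalikaElt g X * (xi n F)⁻¹ : Grp n F) : Matrix (Idx n) (Idx n) F) =
      Matrix.fromBlocks (g : Matrix (Fin n) (Fin n) F) 0 (antidiag n F * ((g : Matrix (Fin n) (Fin n) F) * X))
        (antidiag n F * (g : Matrix (Fin n) (Fin n) F) * antidiag n F) := by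
  change Matrix.fromBlocks 0 1 (antidiag n F) 0 *
    (Matrix.fromBlocks (g : Matrix (Fin n) (Fin n) F) 0 0 (g : Matrix (Fin n) (Fin n) F) * Matrix.fromBlocks 1 X 0 1) *
    Matrix.fromBlocks 0 (antidiag n F) 1 0 = _
  simp [Matrix.fromBlocks_multiply, mul_assoc]

lemma mem_conjShalika_iff_exists {x : Grp n F} :
    x ∈ conjShalika n F ↔ ∃ (g : Matrix.GeneralLinearGroup (Fin n) F)
      (X : Matrix (Fin n) (Fin n) F), x = xi n F * shalikaElt g X * (xi n F)⁻¹ := by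
  constructor
  · rintro ⟨_, ⟨g, X, rfl⟩, rfl⟩
    exact ⟨g, X, rfl⟩
  · rintro ⟨g, X, rfl⟩
    exact ⟨_, ⟨g, X, rfl⟩, rfl⟩

/-- `H` consists of the block lower triangular matrices whose diagonal blocks are `g` and
`w_0 g w_0`. -/
lemma mem_conjShalika {x : Grp n F} :
    x ∈ conjShalika n F ↔ (∀ i j, x (Sum.inl i) (Sum.inr j) = 0) ∧
      ∀ i j, x (Sum.inr i) (Sum.inr j) = x (Sum.inl i.rev) (Sum.inl j.rev) := by
  rw [mem_conjShalika_iff_exists]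
  constructor
  · rintro ⟨g, X, rfl⟩
    rw [coe_xi_conj]
    simp [antidiag_mul_apply, mul_antidiag_apply]
  · rintro ⟨h1, h2⟩
    have hblocks := Matrix.fromBlocks_toBlocks (x : Matrix (Idx n) (Idx n) F)
    have h12 : (x : Matrix (Idx n) (Idx n) F).toBlocks₁₂ = 0 := by
      ext i j; exact h1 i j
    have hdet : IsUnit (x : Matrix (Idx n) (Idx n) F).toBlocks₁₁ := by
      rw [Matrix.isUnit_iff_isUnit_det]
      have h := (Matrix.isUnit_iff_isUnit_det _).1 x.isUnit
      rw [← hblocks, h12, Matrix.det_fromBlocks_zero₁₂] at h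
      exact isUnit_of_mul_isUnit_left h
    obtain ⟨g, hg⟩ := hdet
    refine ⟨g, ((g⁻¹ : Matrix.GeneralLinearGroup (Fin n) F) : Matrix (Fin n) (Fin n) F) *
      (antidiag n F * (x : Matrix (Idx n) (Idx n) F).toBlocks₂₁), ?_⟩
    apply Units.ext
    rw [coe_xi_conj, ← mul_assoc (g : Matrix (Fin n) (Fin n) F), Units.mul_inv, one_mul,
      ← mul_assoc, antidiag_mul_self, one_mul, hg]
    conv_lhs => rw [← hblocks, h12]
    congr 1
    ext i j
    rw [mul_antidiag_apply, antidiag_mul_apply]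
    exact h2 i j

lemma isClosed_conjShalika : IsClosed (conjShalika n F : Set (Grp n F)) := by
  have : (conjShalika n F : Set (Grp n F)) =
      (⋂ i, ⋂ j, {x : Grp n F | x (Sum.inl i) (Sum.inr j) = 0}) ∩
      ⋂ i, ⋂ j, {x : Grp n F | x (Sum.inr i) (Sum.inr j) =
        x (Sum.inl (Fin.rev i)) (Sum.inl (Fin.rev j))} := by
    ext x
    simp [mem_conjShalika]
  rw [this]
  exact (isClosed_iInter fun i => isClosed_iInter fun j =>
    isClosed_eq (continuous_entry _ _) continuous_const).inter
    (isClosed_iInter fun i => isClosed_iInter fun j =>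
      isClosed_eq (continuous_entry _ _) (continuous_entry _ _))

/-! ### The reversal of indices -/

@[simp] lemma revIdx_inl (i : Fin n) : revIdx n (Sum.inl i) = Sum.inr i.rev := rfl

@[simp] lemma revIdx_inr (i : Fin n) : revIdx n (Sum.inr i) = Sum.inl i.rev := rfl

@[simp] lemma revIdx_revIdx (i : Idx n) : revIdx n (revIdx n i) = i := by
  rcases i with i | i <;> simp

lemma revIdx_ne (i : Idx n) : revIdx n i ≠ i := by
  rcases i with i | i <;> simp

lemma pos_inl_lt_inl {i j : Fin n} :
    pos (Sum.inl i : Idx n) < pos (Sum.inl j : Idx n) ↔ i < j := by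
  simp only [pos, finSumFinEquiv_apply_left, Fin.lt_def, Fin.val_castAdd]

lemma pos_inr_lt_inr {i j : Fin n} :
    pos (Sum.inr i : Idx n) < pos (Sum.inr j : Idx n) ↔ i < j := by
  simp only [pos, finSumFinEquiv_apply_right, Fin.lt_def, Fin.val_natAdd]
  omega

lemma pos_inl_lt_inr {i j : Fin n} : pos (Sum.inl i : Idx n) < pos (Sum.inr j : Idx n) := by
  simp only [pos, finSumFinEquiv_apply_left, finSumFinEquiv_apply_right, Fin.lt_def,
    Fin.val_castAdd, Fin.val_natAdd]
  omega

lemma not_pos_inr_lt_inl {i j : Fin n} :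
    ¬ pos (Sum.inr i : Idx n) < pos (Sum.inl j : Idx n) := pos_inl_lt_inr.not_gt

lemma pos_revIdx_lt {i j : Idx n} : pos (revIdx n i) < pos (revIdx n j) ↔ pos j < pos i := by
  rcases i with i | i <;> rcases j with j | j <;>
    simp [pos_inl_lt_inl, pos_inr_lt_inr, pos_inl_lt_inr, not_pos_inr_lt_inl]

/-- The involution `g ↦ w g⁻ᵀ w` of `G`, for the antidiagonal permutation matrix `w`. -/
def transposeInvRev (n : ℕ) (F : Type*) [NontriviallyNormedField F] : Grp n F →* Grp n F where
  toFun g :=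
    { val := ((g⁻¹ : Grp n F) : Matrix (Idx n) (Idx n) F).transpose.submatrix (revIdx n) (revIdx n)
      inv := (g : Matrix (Idx n) (Idx n) F).transpose.submatrix (revIdx n) (revIdx n)
      val_inv := by
        rw [Matrix.submatrix_mul_equiv, ← Matrix.transpose_mul, Units.mul_inv,
          Matrix.transpose_one, Matrix.submatrix_one_equiv]
      inv_val := by
        rw [Matrix.submatrix_mul_equiv, ← Matrix.transpose_mul, Units.inv_mul,
          Matrix.transpose_one, Matrix.submatrix_one_equiv] }
  map_one' := by
    apply Units.ext
    change ((1⁻¹ : Grp n F) : Matrix (Idx n) (Idx n) F).transpose.submatrix _ _ = 1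
    rw [inv_one, Units.val_one, Matrix.transpose_one, Matrix.submatrix_one_equiv]
  map_mul' g h := by
    apply Units.ext
    change (((g * h)⁻¹ : Grp n F) : Matrix (Idx n) (Idx n) F).transpose.submatrix _ _ = _ * _
    rw [mul_inv_rev, Units.val_mul, Matrix.transpose_mul, ← Matrix.submatrix_mul_equiv _ _ _ (revIdx n)]

lemma transposeInvRev_apply (g : Grp n F) (i j : Idx n) :
    transposeInvRev n F g i j = (g⁻¹ : Grp n F) (revIdx n j) (revIdx n i) := rfl

lemma transposeInvRev_transposeInvRev (g : Grp n F) :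
    transposeInvRev n F (transposeInvRev n F g) = g := by
  apply Units.ext
  ext i j
  rw [transposeInvRev_apply, ← map_inv, transposeInvRev_apply]
  simp

lemma continuous_transposeInvRev : Continuous (transposeInvRev n F) := by
  rw [Units.continuous_iff]
  constructor
  · exact continuous_matrix fun _ _ => continuous_inv_entry _ _
  · exact continuous_matrix fun _ _ => continuous_entry _ _

lemma transposeInvRev_mem_borel {g : Grp n F} (hg : g ∈ borelSubgroup n F) :
    transposeInvRev n F g ∈ borelSubgroup n F := fun _ _ hij =>
  inv_mem hg _ _ (pos_revIdx_lt.2 hij)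

lemma transposeInvRev_mem_conjShalika {g : Grp n F} (hg : g ∈ conjShalika n F) :
    transposeInvRev n F g ∈ conjShalika n F := by
  have h := mem_conjShalika.1 (inv_mem hg)
  rw [mem_conjShalika]
  refine ⟨fun i j => h.1 _ _, fun i j => ?_⟩
  rw [transposeInvRev_apply, transposeInvRev_apply]
  simp only [revIdx_inr, revIdx_inl, Fin.rev_rev]
  exact (h.2 j i).symm

lemma transposeInvRev_mem_congruenceSubgroup [IsUltrametricDist F] {ε : Set.Ioo (0 : ℝ) 1}
    {g : Grp n F} (hg : g ∈ congruenceSubgroup n F ε) :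
    transposeInvRev n F g ∈ congruenceSubgroup n F ε := by
  intro i j
  have h := inv_mem hg (revIdx n j) (revIdx n i)
  rw [Matrix.sub_apply] at h ⊢
  have h1 : (1 : Matrix (Idx n) (Idx n) F) (revIdx n j) (revIdx n i) =
      (1 : Matrix (Idx n) (Idx n) F) i j := by
    simp [Matrix.one_apply, eq_comm]
  rw [h1] at h
  exact h

/-! ### The intersection of `P` and `H` -/

/-- The two diagonal blocks of an element of `H` are reversals of each other, and reversal exchanges
upper and lower triangular; if both blocks are upper triangular, both are diagonal. The off-diagonal
blocks vanish, one by membership in `H` and one by membership in `P`. -/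
lemma mem_borel_inf_conjShalika_apply {g : Grp n F} (hP : g ∈ borelSubgroup n F)
    (hH : g ∈ conjShalika n F) {i j : Idx n} (hij : i ≠ j) : g i j = 0 := by
  have h := mem_conjShalika.1 hH
  rcases i with i | i <;> rcases j with j | j
  · rcases lt_or_gt_of_ne (fun h : i = j => hij (by rw [h])) with hlt | hlt
    · have h2 := h.2 i.rev j.rev
      rw [Fin.rev_rev, Fin.rev_rev] at h2
      rw [← h2]
      exact hP _ _ (pos_inr_lt_inr.2 (Fin.rev_lt_rev.2 hlt))
    · exact hP _ _ (pos_inl_lt_inl.2 hlt)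
  · exact h.1 i j
  · exact hP _ _ pos_inl_lt_inr
  · rcases lt_or_gt_of_ne (fun h : i = j => hij (by rw [h])) with hlt | hlt
    · rw [h.2]
      exact hP _ _ (pos_inl_lt_inl.2 (Fin.rev_lt_rev.2 hlt))
    · exact hP _ _ (pos_inr_lt_inr.2 hlt)

lemma commute_of_mem_borel_inf_conjShalika {g h : Grp n F} (hg : g ∈ borelSubgroup n F)
    (hg' : g ∈ conjShalika n F) (hh : h ∈ borelSubgroup n F) (hh' : h ∈ conjShalika n F) :
    Commute g h := by
  have key : ∀ x : Grp n F, x ∈ borelSubgroup n F → x ∈ conjShalika n F →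
      (x : Matrix (Idx n) (Idx n) F) = Matrix.diagonal fun i => x i i := by
    intro x hx hx'
    ext i j
    rcases eq_or_ne i j with rfl | hij
    · simp
    · rw [Matrix.diagonal_apply_ne _ hij, mem_borel_inf_conjShalika_apply hx hx' hij]
  apply Units.ext
  rw [Units.val_mul, Units.val_mul, key g hg hg', key h hh hh', Matrix.diagonal_mul_diagonal,
    Matrix.diagonal_mul_diagonal]
  simp only [mul_comm]

lemma coe_torusElt (t : Idx n → Fˣ) :
    (torusElt t : Matrix (Idx n) (Idx n) F) = Matrix.diagonal fun i => (t i : F) := rfl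

lemma torusElt_mem_borel (t : Idx n → Fˣ) : torusElt t ∈ borelSubgroup n F := by
  intro i j hij
  exact Matrix.diagonal_apply_ne _ fun h => absurd hij (by rw [h]; exact lt_irrefl _)

lemma torusElt_inv (t : Idx n → Fˣ) : (torusElt t)⁻¹ = torusElt t⁻¹ := rfl

lemma torusElt_mem_conjShalika {t : Idx n → Fˣ} (ht : ∀ i, t (revIdx n i) = t i) :
    torusElt t ∈ conjShalika n F := by
  rw [mem_conjShalika]
  refine ⟨fun i j => Matrix.diagonal_apply_ne _ (by simp), fun i j => ?_⟩
  have h := ht (Sum.inr i)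
  rw [revIdx_inr] at h
  rw [coe_torusElt, Matrix.diagonal_apply, Matrix.diagonal_apply]
  simp [h]

/-- This inversion is what makes both the modular character of `P` and the index of a conjugate
insensitive to the stabilizer. -/
lemma transposeInvRev_torusElt {t : Idx n → Fˣ} (ht : ∀ i, t (revIdx n i) = t i) :
    transposeInvRev n F (torusElt t) = (torusElt t)⁻¹ := by
  apply Units.ext
  ext i j
  rw [transposeInvRev_apply, torusElt_inv, coe_torusElt, Matrix.diagonal_apply,
    Matrix.diagonal_apply]
  rcases eq_or_ne i j with rfl | hij
  · simp [ht]
  · simp [hij, hij.symm]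

end SubgroupH

/-! ### Open-orbit factorizations of congruence and Iwahori subgroups -/

section Factorization

variable {F : Type*} [NontriviallyNormedField F] {n : ℕ}

/-! ### Factorization through `P` and torus conjugates of `H` -/

lemma torusElt_conj_apply (s : Idx n → Fˣ) (x : Grp n F) (i j : Idx n) :
    (torusElt s * x * (torusElt s)⁻¹ : Grp n F) i j = s i * x i j * ((s j)⁻¹ : Fˣ) := by
  rw [torusElt_inv, Units.val_mul, Units.val_mul, coe_torusElt, coe_torusElt,
    Matrix.mul_diagonal, Matrix.diagonal_mul]
  rfl

/-- The conjugate `g⁻¹ H g`. -/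
def conjShalikaBy (g : Grp n F) : Subgroup (Grp n F) :=
  (conjShalika n F).comap (MulAut.conj g).toMonoidHom

lemma mem_conjShalikaBy {g x : Grp n F} :
    x ∈ conjShalikaBy g ↔ g * x * g⁻¹ ∈ conjShalika n F := Iff.rfl

lemma isClosed_conjShalikaBy (g : Grp n F) : IsClosed (conjShalikaBy g : Set (Grp n F)) :=
  isClosed_conjShalika.preimage (f := fun x => g * x * g⁻¹) (by fun_prop)

lemma isUpper_one_add {E : Matrix (Idx n) (Idx n) F} (hE : IsUpper E) : IsUpper (1 + E) := by
  intro i j hij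
  have hne : i ≠ j := fun h => absurd hij (by rw [h]; exact lt_irrefl _)
  rw [Matrix.add_apply, Matrix.one_apply_ne hne, hE i j hij, add_zero]

variable [IsUltrametricDist F]

lemma exists_unit_of_entryBound {E : Matrix (Idx n) (Idx n) F} {r : ℝ} (hr : r < 1)
    (hE : EntryBound E r) :
    ∃ g : Grp n F, (g : Matrix (Idx n) (Idx n) F) = 1 + E := by
  have h : EntryBound (1 + E - 1) r := by rwa [add_sub_cancel_left]
  obtain ⟨g, hg⟩ := h.isUnit hr
  exact ⟨g, hg⟩

/-- Additive splitting of a small matrix into an upper triangular one and one tangent to the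
conjugate of `H` by a dominant torus element. -/
lemma exists_split_borel_conjShalikaBy {t : Fin n → Fˣ}
    (ht : ∀ i j, i ≤ j → ‖(t j : F)‖ ≤ ‖(t i : F)‖) (E : Matrix (Idx n) (Idx n) F) (r : ℝ)
    (hr0 : 0 ≤ r) (hr : r < 1) (hE : EntryBound E r) :
    ∃ p ∈ borelSubgroup n F, ∃ q ∈ conjShalikaBy (torusElt (Sum.elim t 1)),
      EntryBound ((p : Matrix (Idx n) (Idx n) F) - 1) r ∧
      EntryBound ((q : Matrix (Idx n) (Idx n) F) - 1) r ∧
      E = ((p : Matrix (Idx n) (Idx n) F) - 1) + ((q : Matrix (Idx n) (Idx n) F) - 1) := by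
  -- `M` is the part tangent to the conjugate of `H`. It copies `E` strictly below the diagonal, so
  -- that `E - M` is upper triangular. The relation tying the two diagonal blocks then forces its
  -- entries above the diagonal inside each block; these carry ratios `t j / t i` with `i ≤ j`, of
  -- norm at most `1` by dominance. The diagonal of `M` is `0`, leaving the diagonal of `E` to `P`.
  let M : Matrix (Idx n) (Idx n) F :=
    Matrix.fromBlocks
      (Matrix.of fun i j => if j < i then E (Sum.inl i) (Sum.inl j)
        else if i < j then (t j : F) / t i * E (Sum.inr i.rev) (Sum.inr j.rev) else 0) 0
      (Matrix.of fun i j => E (Sum.inr i) (Sum.inl j))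
      (Matrix.of fun i j => if j < i then E (Sum.inr i) (Sum.inr j)
        else if i < j then (t i.rev : F) / t j.rev * E (Sum.inl i.rev) (Sum.inl j.rev) else 0)
  have h11 : ∀ i j, M (Sum.inl i) (Sum.inl j) = if j < i then E (Sum.inl i) (Sum.inl j)
      else if i < j then (t j : F) / t i * E (Sum.inr i.rev) (Sum.inr j.rev) else 0 :=
    fun _ _ => rfl
  have h12 : ∀ i j, M (Sum.inl i) (Sum.inr j) = 0 := fun _ _ => rfl
  have h21 : ∀ i j, M (Sum.inr i) (Sum.inl j) = E (Sum.inr i) (Sum.inl j) := fun _ _ => rfl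
  have h22 : ∀ i j, M (Sum.inr i) (Sum.inr j) = if j < i then E (Sum.inr i) (Sum.inr j)
      else if i < j then (t i.rev : F) / t j.rev * E (Sum.inl i.rev) (Sum.inl j.rev) else 0 :=
    fun _ _ => rfl
  clear_value M
  have hratio : ∀ (i j : Fin n) (a : F), i ≤ j → ‖a‖ ≤ r → ‖(t j : F) / t i * a‖ ≤ r := by
    intro i j a hij ha
    rw [norm_mul, norm_div]
    have h1 : ‖(t j : F)‖ / ‖(t i : F)‖ ≤ 1 := div_le_one_of_le₀ (ht i j hij) (norm_nonneg _)
    exact (mul_le_of_le_one_left (norm_nonneg _) h1).trans ha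
  have hM : EntryBound M r := by
    have h0 : ‖(0 : F)‖ ≤ r := by simpa using hr0
    rintro (i | i) (j | j)
    · rw [h11]
      split_ifs with h1 h2
      · exact hE _ _
      · exact hratio _ _ _ h2.le (hE _ _)
      · exact h0
    · rwa [h12]
    · rw [h21]
      exact hE _ _
    · rw [h22]
      split_ifs with h1 h2
      · exact hE _ _
      · exact hratio _ _ _ (Fin.rev_le_rev.2 h2.le) (hE _ _)
      · exact h0
  have hEM : EntryBound (E - M) r := by
    rw [sub_eq_add_neg]
    exact hE.add hM.neg
  obtain ⟨p, hp⟩ := exists_unit_of_entryBound hr hEM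
  obtain ⟨q, hq⟩ := exists_unit_of_entryBound hr hM
  refine ⟨p, ?_, q, ?_, by rwa [hp, add_sub_cancel_left], by rwa [hq, add_sub_cancel_left], ?_⟩
  · change IsUpper (p : Matrix (Idx n) (Idx n) F)
    rw [hp]
    refine isUpper_one_add ?_
    rintro (i | i) (j | j) hij
    · rw [Matrix.sub_apply, h11, if_pos (pos_inl_lt_inl.1 hij), sub_self]
    · exact absurd hij not_pos_inr_lt_inl
    · rw [Matrix.sub_apply, h21, sub_self]
    · rw [Matrix.sub_apply, h22, if_pos (pos_inr_lt_inr.1 hij), sub_self]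
  · rw [mem_conjShalikaBy, mem_conjShalika]
    refine ⟨fun i j => ?_, fun i j => ?_⟩
    · rw [torusElt_conj_apply, hq, Matrix.add_apply, h12, Matrix.one_apply_ne (by simp)]
      simp
    · have hi : (t i.rev : F) ≠ 0 := (t i.rev).ne_zero
      have hj : (t j.rev : F) ≠ 0 := (t j.rev).ne_zero
      rw [torusElt_conj_apply, torusElt_conj_apply, hq, Matrix.add_apply, Matrix.add_apply, h11,
        h22, Matrix.one_apply, Matrix.one_apply]
      simp only [Sum.elim_inr, Sum.elim_inl, Pi.one_apply, Sum.inl.injEq, Sum.inr.injEq,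
        Fin.rev_lt_rev, Fin.rev_rev, Units.val_inv_eq_inv_val, Fin.rev_inj, Units.val_one,
        inv_one, one_mul, mul_one]
      rcases lt_trichotomy i j with h | rfl | h
      · simp only [h.not_gt, h, h.ne, if_false, if_true, zero_add]
        field_simp
      · simp only [lt_irrefl, if_false, if_true, add_zero, mul_one]
        field_simp
      · simp only [h.not_gt, h, h.ne', if_false, if_true, zero_add]
        field_simp
  · rw [hp, hq]
    abel

/-- Iwahori subgroups are contained in the product of `P` and a congruence subgroup. -/
lemma exists_borel_mul_congruence_of_mem_iwahori {b : Grp n F} (hb : b ∈ iwahori n F) :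
    ∃ p ∈ borelSubgroup n F, ∃ ε, ∃ k ∈ congruenceSubgroup n F ε, b = p * k := by
  let u : Matrix (Idx n) (Idx n) F := Matrix.of fun i j => if pos j < pos i then 0 else b i j
  let l : Matrix (Idx n) (Idx n) F := Matrix.of fun i j => if pos j < pos i then b i j else 0
  have hu : ∀ i j, u i j = if pos j < pos i then 0 else b i j := fun _ _ => rfl
  have hl' : ∀ i j, l i j = if pos j < pos i then b i j else 0 := fun _ _ => rfl
  clear_value u l
  have hul : u + l = (b : Matrix (Idx n) (Idx n) F) := by
    ext i j
    rw [Matrix.add_apply, hu, hl']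
    split_ifs <;> simp
  obtain ⟨ε, hl⟩ : ∃ ε : Set.Ioo (0 : ℝ) 1, EntryBound l ε := by
    have h1 : ∀ x : Idx n × Idx n, ‖l x.1 x.2‖ < 1 := by
      intro x
      rw [hl']
      split_ifs with h
      · exact (hb.1 _ _).2 h
      · simp
    have hev : ∀ᶠ r in nhdsWithin (1 : ℝ) (Set.Iio 1), ∀ x : Idx n × Idx n, ‖l x.1 x.2‖ ≤ r :=
      Filter.eventually_all.2 fun x => by
        filter_upwards [mem_nhdsWithin_of_mem_nhds (lt_mem_nhds (h1 x))] with r hr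
        exact hr.le
    have hev2 : ∀ᶠ r in nhdsWithin (1 : ℝ) (Set.Iio 1), 0 < r :=
      mem_nhdsWithin_of_mem_nhds (lt_mem_nhds zero_lt_one)
    obtain ⟨r, hr, hr0, hr1⟩ := (hev.and (hev2.and self_mem_nhdsWithin)).exists
    exact ⟨⟨r, hr0, hr1⟩, fun i j => hr (i, j)⟩
  have hbinv : EntryBound ((b⁻¹ : Grp n F) : Matrix (Idx n) (Idx n) F) 1 :=
    fun i j => (hb.2 i j).1
  -- With `k = 1 - b⁻¹ l` one gets `b k = b - l = u`, which is upper triangular.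
  have hbl : EntryBound (-(((b⁻¹ : Grp n F) : Matrix (Idx n) (Idx n) F) * l)) ε := by
    have h := (hbinv.mul hl zero_le_one ε.2.1.le).neg
    rwa [one_mul] at h
  obtain ⟨k, hk⟩ := exists_unit_of_entryBound ε.2.2 hbl
  have hkK : k ∈ congruenceSubgroup n F ε := by
    rw [mem_congruenceSubgroup, hk, add_sub_cancel_left]
    exact hbl
  refine ⟨b * k, ?_, ε, k⁻¹, inv_mem hkK, by group⟩
  change IsUpper ((b * k : Grp n F) : Matrix (Idx n) (Idx n) F)
  have h1 : ((b * k : Grp n F) : Matrix (Idx n) (Idx n) F) = u := by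
    rw [Units.val_mul, hk, mul_add, mul_one, mul_neg, ← mul_assoc, Units.mul_inv, one_mul,
      ← hul, add_neg_cancel_right]
  rw [h1]
  intro i j hij
  rw [hu, if_pos hij]

variable [ProperSpace F]

lemma congruenceSubgroup_factor_conjShalikaBy {t : Fin n → Fˣ}
    (ht : ∀ i j, i ≤ j → ‖(t j : F)‖ ≤ ‖(t i : F)‖) {ε : Set.Ioo (0 : ℝ) 1} {k : Grp n F}
    (hk : k ∈ congruenceSubgroup n F ε) :
    ∃ p ∈ borelSubgroup n F ⊓ congruenceSubgroup n F ε,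
      ∃ q ∈ conjShalikaBy (torusElt (Sum.elim t 1)) ⊓ congruenceSubgroup n F ε, k = p * q :=
  congruenceSubgroup_factor isClosed_borel (isClosed_conjShalikaBy _)
    (exists_split_borel_conjShalikaBy ht) hk

/-- The case `t = 1` of the preceding factorization; it makes orbits of compact open subgroups of `P
× H` open in `G`. -/
lemma congruenceSubgroup_factor_conjShalika {ε : Set.Ioo (0 : ℝ) 1} {k : Grp n F}
    (hk : k ∈ congruenceSubgroup n F ε) :
    ∃ p ∈ borelSubgroup n F ⊓ congruenceSubgroup n F ε,
      ∃ q ∈ conjShalika n F ⊓ congruenceSubgroup n F ε, k = p * q := by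
  have h1 : torusElt (Sum.elim (1 : Fin n → Fˣ) 1) = (1 : Grp n F) := by
    apply Units.ext
    rw [coe_torusElt, Units.val_one, ← Matrix.diagonal_one]
    congr 1
    ext (i | i) <;> simp
  obtain ⟨p, hp, q, hq, hpq⟩ :=
    congruenceSubgroup_factor_conjShalikaBy (t := 1) (fun _ _ _ => le_rfl) hk
  rw [h1] at hq
  refine ⟨p, hp, q, ⟨?_, hq.2⟩, hpq⟩
  simpa [mem_conjShalikaBy] using hq.1

/-- For dominant `g = diag(t, 1)` the translate `B g⁻¹` of the Iwahori subgroup lies in `P · H`. -/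
lemma iwahori_mul_inv_mem_openOrbit {t : Fin n → Fˣ}
    (ht : ∀ i j, i ≤ j → ‖(t j : F)‖ ≤ ‖(t i : F)‖) {b : Grp n F} (hb : b ∈ iwahori n F) :
    b * (torusElt (Sum.elim t 1))⁻¹ ∈ openOrbit n F := by
  obtain ⟨p, hp, ε, k, hk, rfl⟩ := exists_borel_mul_congruence_of_mem_iwahori hb
  obtain ⟨p', hp', q, hq, rfl⟩ := congruenceSubgroup_factor_conjShalikaBy ht hk
  refine ⟨p * p' * (torusElt (Sum.elim t 1))⁻¹,
    mul_mem (mul_mem hp hp'.1) (inv_mem (torusElt_mem_borel _)), _, hq.1, ?_⟩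
  simp only [MulEquiv.coe_toMonoidHom, MulAut.conj_apply]
  group

end Factorization

/-! ### Triviality of `η` and `δ^{1/2}` where the stabilizer argument needs it -/

section BorelCharacters

variable {F : Type*} [NontriviallyNormedField F] {n : ℕ}

/-! ### Characters of `P` on compact open subgroups and on `P ∩ H` -/

section Modular

variable {G : Type*} [TopologicalSpace G] [Group G] [IsTopologicalGroup G] [LocallyCompactSpace G]

lemma modularCharacter_mul_haar [SigmaCompactSpace G] [MeasurableSpace G]
    [BorelSpace G] (μ : Measure G) [μ.IsHaarMeasure] [μ.InnerRegular] (g : G) {U : Set G}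
    (hU : IsOpen U) :
    μ ((fun x => x * g) ⁻¹' U) = Measure.modularCharacter g * μ U := by
  have h := congrArg (fun ν : Measure G => ν U)
    (Measure.map_right_mul_eq_modularCharacterFun_smul μ g)
  simp only [Measure.smul_apply] at h
  rw [Measure.map_apply (measurable_mul_const g) hU.measurableSet] at h
  exact h

/-- Right translation by `g ∈ U` maps `U` to itself, and `U` has finite nonzero Haar measure. -/
lemma modularCharacter_eq_one_of_mem [SigmaCompactSpace G] {U : Subgroup G}
    (hU : IsOpen (U : Set G)) (hUc : IsCompact (U : Set G)) {g : G} (hg : g ∈ U) :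
    Measure.modularCharacter g = 1 := by
  borelize G
  have h := modularCharacter_mul_haar (Measure.haar : Measure G) g hU
  have h1 : (fun x => x * g) ⁻¹' (U : Set G) = U := by
    ext x
    exact Subgroup.mul_mem_cancel_right U hg
  rw [h1] at h
  have h0 : (Measure.haar : Measure G) U ≠ 0 := (hU.measure_pos _ ⟨1, U.one_mem⟩).ne'
  have h2 := (ENNReal.mul_eq_right h0 hUc.measure_lt_top.ne).1 h.symm
  exact_mod_cast h2

/-- The modular character is invariant under automorphisms which preserve some compact open
subgroup. -/
lemma modularCharacter_map [SigmaCompactSpace G] {U : Subgroup G}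
    (hU : IsOpen (U : Set G)) (hUc : IsCompact (U : Set G)) (θ : G ≃* G) (hθ : Continuous θ)
    (hθ' : Continuous θ.symm) (g : G) :
    Measure.modularCharacter (θ g) = Measure.modularCharacter g := by
  borelize G
  let μ : Measure G := Measure.haar
  have : (μ.map θ).IsHaarMeasure := θ.isHaarMeasure_map μ hθ hθ'
  have : (μ.map θ).InnerRegular := Measure.InnerRegular.map_of_continuous hθ
  -- The modular character may be computed from any Haar measure, here `μ` and its image under `θ`;
  -- the set `U` seen by the image is `θ ⁻¹' U` seen by `μ`.
  have h1 := modularCharacter_mul_haar (μ.map θ) (θ g) hU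
  have h2 := modularCharacter_mul_haar μ g (hU.preimage hθ)
  rw [Measure.map_apply hθ.measurable hU.measurableSet,
    Measure.map_apply hθ.measurable (hU.preimage (continuous_mul_const _)).measurableSet] at h1
  have h3 : θ ⁻¹' ((fun x => x * θ g) ⁻¹' (U : Set G)) = (fun x => x * g) ⁻¹' (θ ⁻¹' (U : Set G)) := by
    ext x; simp
  rw [h3, h2] at h1
  have h0 : μ (θ ⁻¹' (U : Set G)) ≠ 0 :=
    ((hU.preimage hθ).measure_pos _ ⟨1, by simp [U.one_mem]⟩).ne'
  have hc : IsCompact (θ ⁻¹' (U : Set G)) := by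
    have h : θ ⁻¹' (U : Set G) = θ.symm '' (U : Set G) :=
      (θ.symm.toEquiv.image_eq_preimage_symm _).symm
    rw [h]
    exact hUc.image hθ'
  have h4 := (ENNReal.mul_left_inj h0 hc.measure_lt_top.ne).1 h1
  exact_mod_cast h4.symm

end Modular

variable [IsUltrametricDist F]

/-- The intersection of `P` with a congruence subgroup, as a subgroup of `P`. -/
def borelCongruence (n : ℕ) (F : Type*) [NontriviallyNormedField F] [IsUltrametricDist F]
    (ε : Set.Ioo (0 : ℝ) 1) : Subgroup (borelSubgroup n F) :=
  (congruenceSubgroup n F ε).subgroupOf (borelSubgroup n F)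

lemma isOpen_borelCongruence (ε : Set.Ioo (0 : ℝ) 1) :
    IsOpen (borelCongruence n F ε : Set (borelSubgroup n F)) :=
  (isOpen_congruenceSubgroup ε).preimage continuous_subtype_val

/-- Diagonal entries at distance less than `1` from `1` are units of norm `1`, on which unramified
characters are trivial. -/
lemma borelChar_eq_one_of_mem {η : Idx n → Fˣ →* ℂˣ} (hη : ∀ i, IsUnramified (η i))
    {ε : Set.Ioo (0 : ℝ) 1} {p : borelSubgroup n F}
    (hp : (p : Grp n F) ∈ congruenceSubgroup n F ε) : borelChar η p = 1 := by
  change ∏ i, η i (diagPart p i) = 1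
  refine Finset.prod_eq_one fun i _ => hη i _ ?_
  have h := hp i i
  rw [Matrix.sub_apply, Matrix.one_apply_eq] at h
  change ‖((p : Grp n F) i i : F)‖ = 1
  have h1 : ‖((p : Grp n F) i i - 1 : F)‖ < ‖(1 : F)‖ := by
    rw [norm_one]
    exact h.trans_lt ε.2.2
  have h2 := IsUltrametricDist.norm_add_eq_max_of_norm_ne_norm h1.ne
  rw [sub_add_cancel, max_eq_right h1.le, norm_one] at h2
  exact h2

lemma continuous_borelChar {η : Idx n → Fˣ →* ℂˣ} (hη : ∀ i, IsUnramified (η i)) :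
    Continuous fun p : borelSubgroup n F => (borelChar η p : ℂ) := by
  have ε : Set.Ioo (0 : ℝ) 1 := Classical.arbitrary _
  refine IsLocallyConstant.continuous ((IsLocallyConstant.iff_eventually_eq _).2 fun p => ?_)
  have h : ∀ᶠ q in nhds p, p⁻¹ * q ∈ borelCongruence n F ε := by
    have hc : Filter.Tendsto (fun q => p⁻¹ * q) (nhds p) (nhds 1) := by
      simpa using (continuous_const_mul p⁻¹).tendsto p
    exact hc ((isOpen_borelCongruence ε).mem_nhds (one_mem _))
  filter_upwards [h] with q hq
  rw [← mul_inv_cancel_left p q, map_mul, borelChar_eq_one_of_mem hη (p := p⁻¹ * q) hq, mul_one]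

/-- The restriction of `g ↦ w g⁻ᵀ w` to `P`. -/
def borelTransposeInvRev (n : ℕ) (F : Type*) [NontriviallyNormedField F] :
    borelSubgroup n F ≃* borelSubgroup n F where
  toFun p := ⟨transposeInvRev n F p, transposeInvRev_mem_borel p.2⟩
  invFun p := ⟨transposeInvRev n F p, transposeInvRev_mem_borel p.2⟩
  left_inv _ := Subtype.ext (transposeInvRev_transposeInvRev _)
  right_inv _ := Subtype.ext (transposeInvRev_transposeInvRev _)
  map_mul' _ _ := Subtype.ext (map_mul _ _ _)

variable [ProperSpace F]

lemma isCompact_borelCongruence (ε : Set.Ioo (0 : ℝ) 1) :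
    IsCompact (borelCongruence n F ε : Set (borelSubgroup n F)) :=
  isClosed_borel.isClosedEmbedding_subtypeVal.isCompact_preimage (isCompact_congruenceSubgroup ε)

lemma sqrtDelta_eq_one_of_mem {ε : Set.Ioo (0 : ℝ) 1} {p : borelSubgroup n F}
    (hp : (p : Grp n F) ∈ congruenceSubgroup n F ε) : sqrtDelta p = 1 := by
  rw [sqrtDelta, modularCharacter_eq_one_of_mem (isOpen_borelCongruence ε)
    (isCompact_borelCongruence ε) hp]
  simp

lemma continuous_sqrtDelta : Continuous (sqrtDelta : borelSubgroup n F → ℂ) := by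
  have ε : Set.Ioo (0 : ℝ) 1 := Classical.arbitrary _
  refine IsLocallyConstant.continuous ((IsLocallyConstant.iff_eventually_eq _).2 fun p => ?_)
  have h : ∀ᶠ q in nhds p, p⁻¹ * q ∈ borelCongruence n F ε := by
    have hc : Filter.Tendsto (fun q => p⁻¹ * q) (nhds p) (nhds 1) := by
      simpa using (continuous_const_mul p⁻¹).tendsto p
    exact hc ((isOpen_borelCongruence ε).mem_nhds (one_mem _))
  filter_upwards [h] with q hq
  rw [← mul_inv_cancel_left p q, sqrtDelta_mul, sqrtDelta_eq_one_of_mem (p := p⁻¹ * q) hq, mul_one]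

/-- The automorphism `θ` of `P` preserves `δ` and sends `a` to `a⁻¹`, so `δ(a)² = 1`; positivity
gives `δ(a) = 1` without any formula for `δ`. -/
lemma sqrtDelta_torusElt {t : Idx n → Fˣ} (ht : ∀ i, t (revIdx n i) = t i) :
    sqrtDelta ⟨torusElt t, torusElt_mem_borel t⟩ = 1 := by
  have ε : Set.Ioo (0 : ℝ) 1 := Classical.arbitrary _
  set a : borelSubgroup n F := ⟨torusElt t, torusElt_mem_borel t⟩ with ha
  have hc : Continuous (borelTransposeInvRev n F) :=
    (continuous_transposeInvRev.comp continuous_subtype_val).subtype_mk _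
  have h1 := modularCharacter_map (isOpen_borelCongruence ε) (isCompact_borelCongruence ε)
    (borelTransposeInvRev n F) hc hc a
  have h2 : borelTransposeInvRev n F a = a⁻¹ := Subtype.ext (transposeInvRev_torusElt ht)
  rw [h2] at h1
  have h3 : Measure.modularCharacter a * Measure.modularCharacter a = 1 := by
    conv_lhs => enter [1]; rw [← h1]
    rw [← map_mul, inv_mul_cancel, map_one]
  have h4 : Measure.modularCharacter a = 1 := by
    have := mul_self_eq_one_iff.1 (show (Measure.modularCharacter a : ℝ) *
      (Measure.modularCharacter a : ℝ) = 1 by exact_mod_cast h3)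
    rcases this with h | h
    · exact_mod_cast h
    · have h5 : (0 : ℝ) ≤ Measure.modularCharacter a := NNReal.coe_nonneg _
      linarith
  rw [sqrtDelta, h4]
  simp

end BorelCharacters

/-! ### Orbits of subgroups and sums of translates -/

section Orbits

variable {M X : Type*} [Group M] [MulAction M X]

/-- The orbit `W · x` of a point under a subgroup. -/
def subgroupOrbit (W : Subgroup M) (x : X) : Set X := {y | ∃ w ∈ W, y = w • x}

lemma smul_mem_subgroupOrbit {W : Subgroup M} {x y : X} {w : M} (hw : w ∈ W) :
    w • y ∈ subgroupOrbit W x ↔ y ∈ subgroupOrbit W x := by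
  constructor
  · rintro ⟨v, hv, h⟩
    exact ⟨w⁻¹ * v, mul_mem (inv_mem hw) hv, by rw [mul_smul, ← h, inv_smul_smul]⟩
  · rintro ⟨v, hv, rfl⟩
    exact ⟨w * v, mul_mem hw hv, (mul_smul _ _ _).symm⟩

lemma self_mem_subgroupOrbit (W : Subgroup M) (x : X) : x ∈ subgroupOrbit W x :=
  ⟨1, one_mem _, (one_smul _ _).symm⟩

lemma mem_subgroupOrbit_comap_conj {W : Subgroup M} {c : M} {x y : X} :
    y ∈ subgroupOrbit (W.comap (MulAut.conj c).toMonoidHom) x ↔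
      c • y ∈ subgroupOrbit W (c • x) := by
  constructor
  · rintro ⟨w, hw, rfl⟩
    refine ⟨c * w * c⁻¹, hw, ?_⟩
    rw [mul_smul, mul_smul, inv_smul_smul]
  · rintro ⟨w, hw, h⟩
    refine ⟨c⁻¹ * w * c, ?_, ?_⟩
    · change c * (c⁻¹ * w * c) * c⁻¹ ∈ W
      have : c * (c⁻¹ * w * c) * c⁻¹ = w := by group
      rwa [this]
    · rw [mul_smul, mul_smul, ← h, inv_smul_smul]

/-- The sum of the translates of the indicator function of `W' · x` by representatives of the
cosets of `W'` in `W` is a positive multiple of the indicator function of `W · x`. -/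
lemma exists_sum_indicator_subgroupOrbit {W' W : Subgroup M} (hle : W' ≤ W)
    (hfin : W'.relIndex W ≠ 0) (x : X) :
    ∃ (s : Finset M) (m : ℕ), (∀ g ∈ s, g ∈ W) ∧ s.card = W'.relIndex W ∧ m ≠ 0 ∧
      ((∀ g ∈ W, g • x = x → g ∈ W') → m = 1) ∧
      ∀ y, ∑ g ∈ s, (subgroupOrbit W' x).indicator (1 : X → ℂ) (g⁻¹ • y) =
        m * (subgroupOrbit W x).indicator (1 : X → ℂ) y := by
  classical
  let Q := W ⧸ W'.subgroupOf W
  have : (W'.subgroupOf W).FiniteIndex := ⟨hfin⟩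
  have hQ : Finite Q := Subgroup.finite_quotient_of_finiteIndex
  have := Fintype.ofFinite Q
  have hout : ∀ q : Q, (QuotientGroup.mk q.out : Q) = q := fun q => Quotient.out_eq' q
  have hinj : Function.Injective fun q : Q => (q.out : M) := by
    intro q q' h
    rw [← hout q, ← hout q', Subtype.ext h]
  -- Membership does not depend on the coset representative, so moving the point by `w` amounts to
  -- moving the coset by `w⁻¹`.
  have key : ∀ w : W, ∀ q : Q, (((q.out : W) : M)⁻¹ • (w : M) • x ∈ subgroupOrbit W' x ↔
      ((((w⁻¹ • q : Q).out : W) : M)⁻¹ • x ∈ subgroupOrbit W' x)) := by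
    intro w q
    have h1 : (QuotientGroup.mk (w⁻¹ * q.out) : Q) = w⁻¹ • q := by
      conv_rhs => rw [← hout q]
      rfl
    obtain ⟨u, hu⟩ := QuotientGroup.mk_out_eq_mul (W'.subgroupOf W) (w⁻¹ * q.out)
    rw [h1] at hu
    have hu' : ((u : W) : M)⁻¹ ∈ W' := inv_mem u.2
    rw [hu, Subgroup.coe_mul, Subgroup.coe_mul, mul_inv_rev, mul_inv_rev, mul_smul, mul_smul]
    rw [smul_mem_subgroupOrbit hu']
    simp
  -- The multiplicity with which the translates of `W' · x` cover `x`; the trivial coset always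
  -- contributes, and it is the only one when the stabilizer of `x` in `W` lies in `W'`.
  let m : ℕ := (Finset.univ.filter fun q : Q => ((q.out : M)⁻¹ • x ∈ subgroupOrbit W' x)).card
  have hone : ((QuotientGroup.mk (1 : W) : Q).out : M)⁻¹ • x ∈ subgroupOrbit W' x := by
    obtain ⟨u, hu⟩ := QuotientGroup.mk_out_eq_mul (W'.subgroupOf W) 1
    rw [hu, one_mul, ← Subgroup.coe_inv]
    exact ⟨_, inv_mem u.2, rfl⟩
  refine ⟨Finset.univ.image fun q : Q => (q.out : M), m, ?_, ?_, ?_, ?_, ?_⟩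
  · intro g hg
    obtain ⟨q, -, rfl⟩ := Finset.mem_image.1 hg
    exact q.out.2
  · rw [Finset.card_image_of_injective _ hinj, Finset.card_univ, ← Nat.card_eq_fintype_card]
    rfl
  · exact Finset.card_ne_zero_of_mem (Finset.mem_filter.2 ⟨Finset.mem_univ _, hone⟩)
  · intro hstab
    refine Finset.card_eq_one.2 ⟨QuotientGroup.mk 1, ?_⟩
    ext q
    rw [Finset.mem_filter, Finset.mem_singleton]
    constructor
    · rintro ⟨-, v, hv, h⟩
      have h2 : (q.out : M) * v ∈ W' := hstab _ (mul_mem q.out.2 (hle hv)) (by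
        rw [mul_smul, ← h, smul_inv_smul])
      have h3 : (q.out : M) ∈ W' := (Subgroup.mul_mem_cancel_right _ hv).1 h2
      rw [← hout q, eq_comm, QuotientGroup.eq]
      simpa [Subgroup.mem_subgroupOf] using h3
    · rintro rfl
      exact ⟨Finset.mem_univ _, hone⟩
  · intro y
    rw [Finset.sum_image fun _ _ _ _ h => hinj h]
    by_cases hy : y ∈ subgroupOrbit W x
    · obtain ⟨w, hw, rfl⟩ := hy
      rw [Set.indicator_of_mem (show w • x ∈ subgroupOrbit W x from ⟨w, hw, rfl⟩)]
      simp only [Pi.one_apply, mul_one, Set.indicator_apply]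
      rw [show (m : ℂ) = ∑ q : Q, if ((q.out : M)⁻¹ • x ∈ subgroupOrbit W' x) then (1 : ℂ) else 0
        from (Finset.sum_boole _ _).symm]
      exact Fintype.sum_equiv (MulAction.toPerm (⟨w, hw⟩ : W)⁻¹ : Equiv.Perm Q) _ _
        fun q => if_congr (key ⟨w, hw⟩ q) rfl rfl
    · rw [Set.indicator_of_notMem hy, mul_zero]
      refine Finset.sum_eq_zero fun q _ => Set.indicator_of_notMem (fun h => hy ?_) _
      obtain ⟨v, hv, h2⟩ := h
      exact ⟨q.out * v, mul_mem q.out.2 (hle hv), by rw [mul_smul, ← h2, smul_inv_smul]⟩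

end Orbits

/-! ### `P × H` acting on `G`, and its compact open subgroups -/

section TwoSidedAction

variable {F : Type*} [NontriviallyNormedField F] {n : ℕ}

/-! ### The two-sided action of `G × G` -/

/-- The action `(p, h) · x = p x h⁻¹` of `G × G` on `G`. -/
instance twoSidedAction : MulAction (Grp n F × Grp n F) (Grp n F) where
  smul c x := c.1 * x * c.2⁻¹
  one_smul x := by
    change (1 : Grp n F) * x * (1 : Grp n F)⁻¹ = x
    simp
  mul_smul c d x := by
    change c.1 * d.1 * x * (c.2 * d.2)⁻¹ = c.1 * (d.1 * x * d.2⁻¹) * c.2⁻¹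
    group

lemma twoSided_smul (c : Grp n F × Grp n F) (x : Grp n F) : c • x = c.1 * x * c.2⁻¹ := rfl

lemma continuous_twoSided_smul_left (x : Grp n F) :
    Continuous fun c : Grp n F × Grp n F => c • x := by
  simp only [twoSided_smul]
  fun_prop

lemma continuous_twoSided_smul_right (c : Grp n F × Grp n F) :
    Continuous fun x : Grp n F => c • x := by
  simp only [twoSided_smul]
  fun_prop

/-- The action of `G × G` on test functions, `f ↦ (x ↦ f(c⁻¹ · x))`. -/
def testTwoSided (c : Grp n F × Grp n F) (f : testFunctions n F) : testFunctions n F :=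
  testLeft c.1 (testRight c.2 f)

lemma testTwoSided_apply (c : Grp n F × Grp n F) (f : testFunctions n F) (x : Grp n F) :
    (testTwoSided c f : Grp n F → ℂ) x = (f : Grp n F → ℂ) (c⁻¹ • x) := by
  rw [twoSided_smul, Prod.fst_inv, Prod.snd_inv, inv_inv]
  rfl

lemma testTwoSided_mul (c d : Grp n F × Grp n F) (f : testFunctions n F) :
    testTwoSided (c * d) f = testTwoSided c (testTwoSided d f) := by
  apply Subtype.ext
  funext x
  rw [testTwoSided_apply, testTwoSided_apply, testTwoSided_apply, mul_inv_rev, mul_smul]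

lemma testTwoSided_one (f : testFunctions n F) : testTwoSided 1 f = f := by
  apply Subtype.ext
  funext x
  rw [testTwoSided_apply, inv_one, one_smul]

/-- The group `P × H`, acting on `G` with open orbit `P · H`. -/
def borelProdConjShalika (n : ℕ) (F : Type*) [NontriviallyNormedField F] :
    Subgroup (Grp n F × Grp n F) :=
  (borelSubgroup n F).prod (conjShalika n F)

lemma exists_smul_one_of_mem_openOrbit {x : Grp n F} (hx : x ∈ openOrbit n F) :
    ∃ c ∈ borelProdConjShalika n F, x = c • (1 : Grp n F) := by
  obtain ⟨p, hp, h, hh, rfl⟩ := hx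
  exact ⟨(p, h⁻¹), ⟨hp, (conjShalika n F).inv_mem hh⟩, by simp [twoSided_smul]⟩

/-- The indicator function of a compact open set. -/
def indicatorTest (S : Set (Grp n F)) (hc : IsCompact S) (ho : IsOpen S) : testFunctions n F :=
  ⟨S.indicator 1,
    (LocallyConstant.indicator (LocallyConstant.const (Grp n F) (1 : ℂ))
      ⟨hc.isClosed, ho⟩).isLocallyConstant,
    HasCompactSupport.intro hc fun _ hy => Set.indicator_of_notMem hy _⟩

/-! ### Compact open subgroups of `P × H` -/

variable [IsUltrametricDist F]

/-- The product of the intersections of a congruence subgroup with `P` and with `H`. -/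
def pairCongruence (n : ℕ) (F : Type*) [NontriviallyNormedField F] [IsUltrametricDist F]
    (ε : Set.Ioo (0 : ℝ) 1) : Subgroup (Grp n F × Grp n F) :=
  borelProdConjShalika n F ⊓ (congruenceSubgroup n F ε).prod (congruenceSubgroup n F ε)

/-- Compact subgroups of `P × H` which are neighbourhoods of the identity. -/
structure IsCompactOpenIn (W : Subgroup (Grp n F × Grp n F)) : Prop where
  le : W ≤ borelProdConjShalika n F
  isCompact : IsCompact (W : Set (Grp n F × Grp n F))
  exists_le : ∃ ε, pairCongruence n F ε ≤ W

lemma pairCongruence_mono {ε δ : Set.Ioo (0 : ℝ) 1} (h : ε ≤ δ) :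
    pairCongruence n F ε ≤ pairCongruence n F δ :=
  inf_le_inf_left _ (Subgroup.prod_mono (congruenceSubgroup_mono h) (congruenceSubgroup_mono h))

variable [ProperSpace F]

lemma isCompactOpenIn_pairCongruence (ε : Set.Ioo (0 : ℝ) 1) :
    IsCompactOpenIn (pairCongruence n F ε) := by
  refine ⟨inf_le_left, ?_, ε, le_rfl⟩
  have h : IsClosed (borelProdConjShalika n F : Set (Grp n F × Grp n F)) :=
    isClosed_borel.prod isClosed_conjShalika
  exact ((isCompact_congruenceSubgroup ε).prod (isCompact_congruenceSubgroup ε)).inter_left h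

omit [ProperSpace F] in
lemma IsCompactOpenIn.inf {W W' : Subgroup (Grp n F × Grp n F)} (h : IsCompactOpenIn W)
    (h' : IsCompactOpenIn W') : IsCompactOpenIn (W ⊓ W') := by
  obtain ⟨ε, hε⟩ := h.exists_le
  obtain ⟨δ, hδ⟩ := h'.exists_le
  exact ⟨inf_le_left.trans h.le, h.isCompact.inter h'.isCompact, min ε δ,
    le_inf ((pairCongruence_mono (min_le_left _ _)).trans hε)
      ((pairCongruence_mono (min_le_right _ _)).trans hδ)⟩

lemma IsCompactOpenIn.comap_conj {W : Subgroup (Grp n F × Grp n F)} (h : IsCompactOpenIn W)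
    {c : Grp n F × Grp n F} (hc : c ∈ borelProdConjShalika n F) :
    IsCompactOpenIn (W.comap (MulAut.conj c).toMonoidHom) := by
  refine ⟨fun g hg => ?_, ?_, ?_⟩
  · have h1 : c * g * c⁻¹ ∈ borelProdConjShalika n F := h.le hg
    have h2 := mul_mem (mul_mem (inv_mem hc) h1) hc
    have h3 : c⁻¹ * (c * g * c⁻¹) * c = g := by group
    rwa [h3] at h2
  · exact ((Homeomorph.mulLeft c).trans (Homeomorph.mulRight c⁻¹)).isCompact_preimage.2 h.isCompact
  · obtain ⟨ε, hε⟩ := h.exists_le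
    have hU : ∀ x : Grp n F, (fun y => x * y * x⁻¹) ⁻¹' (congruenceSubgroup n F ε : Set (Grp n F)) ∈
        nhds (1 : Grp n F) := by
      intro x
      refine ((isOpen_congruenceSubgroup ε).preimage (by fun_prop)).mem_nhds ?_
      simp [one_mem]
    obtain ⟨δ, hδ⟩ := exists_congruenceSubgroup_subset (Filter.inter_mem (hU c.1) (hU c.2))
    refine ⟨δ, fun g hg => hε ⟨mul_mem (mul_mem hc hg.1) ((borelProdConjShalika n F).inv_mem hc), ?_, ?_⟩⟩
    · exact (hδ hg.2.1).1
    · exact (hδ hg.2.2).2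

-- An open subgroup of a compact group has finite index; here the open subgroup is cut out of `W` by
-- a product of congruence subgroups.
omit [ProperSpace F] in
lemma IsCompactOpenIn.relIndex_ne_zero {W W' : Subgroup (Grp n F × Grp n F)}
    (h : IsCompactOpenIn W) (h' : IsCompactOpenIn W') : W'.relIndex W ≠ 0 := by
  obtain ⟨δ, hδ⟩ := h'.exists_le
  have : CompactSpace W := isCompact_iff_compactSpace.1 h.isCompact
  have hopen : IsOpen ((((congruenceSubgroup n F δ).prod (congruenceSubgroup n F δ)).subgroupOf W :
      Subgroup W) : Set W) :=
    ((isOpen_congruenceSubgroup δ).prod (isOpen_congruenceSubgroup δ)).preimage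
      continuous_subtype_val
  have hfin := Subgroup.quotient_finite_of_isOpen _ hopen
  have h1 : ((congruenceSubgroup n F δ).prod (congruenceSubgroup n F δ)).relIndex W ≠ 0 :=
    (Subgroup.finiteIndex_of_finite_quotient).index_ne_zero
  have h2 : (borelProdConjShalika n F).relIndex W ≠ 0 := by
    rw [Subgroup.relIndex_eq_one.2 h.le]
    exact one_ne_zero
  exact fun h0 => Subgroup.relIndex_inf_ne_zero h2 h1 (Subgroup.relIndex_eq_zero_of_le_left hδ h0)

/-- Near `1` this is the factorization of a congruence subgroup through `P` and `H`; elsewhere on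
the orbit it is transported by `W`. -/
lemma IsCompactOpenIn.isOpen_orbit {W : Subgroup (Grp n F × Grp n F)} (h : IsCompactOpenIn W) :
    IsOpen (subgroupOrbit W (1 : Grp n F)) := by
  obtain ⟨ε, hε⟩ := h.exists_le
  rw [isOpen_iff_mem_nhds]
  rintro _ ⟨w, hw, rfl⟩
  have hU : (fun y : Grp n F => w⁻¹ • y) ⁻¹' (congruenceSubgroup n F ε : Set (Grp n F)) ∈
      nhds (w • (1 : Grp n F)) :=
    ((isOpen_congruenceSubgroup ε).preimage (continuous_twoSided_smul_right _)).mem_nhds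
      (by simp [one_mem])
  filter_upwards [hU] with y hy
  obtain ⟨p, hp, q, hq, hpq⟩ := congruenceSubgroup_factor_conjShalika hy
  rw [← smul_mem_subgroupOrbit (inv_mem hw)]
  refine ⟨(p, q⁻¹), hε ⟨⟨hp.1, (conjShalika n F).inv_mem hq.1⟩, hp.2,
    (congruenceSubgroup n F ε).inv_mem hq.2⟩, ?_⟩
  change w⁻¹ • y = p * q at hpq
  rw [hpq]
  simp [twoSided_smul]

omit [ProperSpace F] in
lemma IsCompactOpenIn.isCompact_orbit {W : Subgroup (Grp n F × Grp n F)}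
    (h : IsCompactOpenIn W) : IsCompact (subgroupOrbit W (1 : Grp n F)) := by
  have h1 : subgroupOrbit W (1 : Grp n F) =
      (fun c : Grp n F × Grp n F => c • (1 : Grp n F)) '' (W : Set (Grp n F × Grp n F)) := by
    ext y
    simp [subgroupOrbit, eq_comm]
  rw [h1]
  exact h.isCompact.image (continuous_twoSided_smul_left _)

/-- The indicator function of the orbit of the identity under a compact open subgroup of
`P × H`. -/
def orbitTest (W : Subgroup (Grp n F × Grp n F)) (h : IsCompactOpenIn W) : testFunctions n F :=
  indicatorTest (subgroupOrbit W 1) h.isCompact_orbit h.isOpen_orbit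

/-! ### The two-sided involution and the index of a conjugate -/

omit [ProperSpace F] in
/-- Conjugation by an element inverted by the involution does not change relative indices. -/
lemma relIndex_comap_conj_pairCongruence (ε : Set.Ioo (0 : ℝ) 1) {a : Grp n F}
    (ha : transposeInvRev n F a = a⁻¹) :
    ((pairCongruence n F ε).comap (MulAut.conj (a, a)).toMonoidHom).relIndex
        (pairCongruence n F ε) =
      (pairCongruence n F ε).relIndex
        ((pairCongruence n F ε).comap (MulAut.conj (a, a)).toMonoidHom) := by
  set W := pairCongruence n F ε
  let Θ : Grp n F × Grp n F →* Grp n F × Grp n F :=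
    (transposeInvRev n F).prodMap (transposeInvRev n F)
  have hΘΘ : ∀ c, Θ (Θ c) = c := fun c =>
    Prod.ext (transposeInvRev_transposeInvRev _) (transposeInvRev_transposeInvRev _)
  have hΘW : ∀ c ∈ W, Θ c ∈ W := fun c hc =>
    ⟨⟨transposeInvRev_mem_borel hc.1.1, transposeInvRev_mem_conjShalika hc.1.2⟩,
      transposeInvRev_mem_congruenceSubgroup hc.2.1, transposeInvRev_mem_congruenceSubgroup hc.2.2⟩
  have hcomap : W.comap Θ = W := by
    ext c
    refine ⟨fun hc => ?_, hΘW c⟩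
    have h := hΘW _ hc
    rwa [hΘΘ] at h
  have hΘa : Θ (a, a) = (a, a)⁻¹ := Prod.ext ha ha
  -- Write `c = (a, a)`. Conjugating by `c` turns the left side into the index of `W` relative to `c
  -- W c⁻¹`; applying `Θ`, which fixes `W` and inverts `c`, replaces `c W c⁻¹` by `c⁻¹ W c`.
  rw [Subgroup.relIndex_comap]
  conv_lhs => rw [← hcomap, Subgroup.relIndex_comap, hcomap]
  congr 1
  ext c
  constructor
  · rintro ⟨_, ⟨d, hd, rfl⟩, rfl⟩
    change (a, a) * Θ ((a, a) * d * (a, a)⁻¹) * (a, a)⁻¹ ∈ W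
    have h : (a, a) * Θ ((a, a) * d * (a, a)⁻¹) * (a, a)⁻¹ = Θ d := by
      rw [map_mul, map_mul, map_inv, hΘa]
      group
    rw [h]
    exact hΘW d hd
  · intro hc
    refine ⟨_, ⟨_, hΘW _ hc, rfl⟩, ?_⟩
    change Θ ((a, a) * Θ ((a, a) * c * (a, a)⁻¹) * (a, a)⁻¹) = c
    rw [map_mul, map_mul, map_inv, hΘa, hΘΘ]
    group

end TwoSidedAction

/-! ### Comparison of orbit indicators and reduction of test functions to them -/

section OpenOrbit

variable {F : Type*} [NontriviallyNormedField F] {n : ℕ} [IsUltrametricDist F] [ProperSpace F]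

/-! ### Vanishing of equivariant distributions on the open orbit -/

section Vanishing

variable {D : testFunctions n F →ₗ[ℂ] ℂ}

/-- If `W' ≤ W` both fix `D`, then the values of `D` on the indicator functions of the orbits of
the identity differ by nonzero factors. -/
lemma exists_card_mul_orbitTest {W W' : Subgroup (Grp n F × Grp n F)} (h : IsCompactOpenIn W)
    (h' : IsCompactOpenIn W') (hle : W' ≤ W)
    (hD : ∀ c ∈ W, ∀ f, D (testTwoSided c f) = D f) :
    ∃ m : ℕ, m ≠ 0 ∧ ((∀ g ∈ W, g • (1 : Grp n F) = 1 → g ∈ W') → m = 1) ∧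
      (W'.relIndex W : ℂ) * D (orbitTest W' h') = m * D (orbitTest W h) := by
  obtain ⟨s, m, hsW, hcard, hm, hm1, hsum⟩ :=
    exists_sum_indicator_subgroupOrbit hle (h.relIndex_ne_zero h') (1 : Grp n F)
  refine ⟨m, hm, hm1, ?_⟩
  have hfun : ∑ g ∈ s, testTwoSided g (orbitTest W' h') = (m : ℂ) • orbitTest W h := by
    apply Subtype.ext
    funext x
    rw [Submodule.coe_sum, Finset.sum_apply]
    simp only [testTwoSided_apply]
    exact hsum x
  have h1 := congrArg D hfun
  rw [map_sum, Finset.sum_congr rfl fun g hg => hD g (hsW g hg) _, Finset.sum_const, hcard,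
    map_smul, nsmul_eq_mul, smul_eq_mul] at h1
  exact h1

variable (hquasi : ∀ c ∈ borelProdConjShalika n F, ∃ z : ℂ, ∀ f, D (testTwoSided c f) = z * D f)
  (hfix : ∀ ε, ∀ c ∈ pairCongruence n F ε, ∀ f, D (testTwoSided c f) = D f)

-- The scalar by which `c⁻¹` acts on `D` enters once in each direction, so it need not be known to
-- be nonzero.
omit [IsUltrametricDist F] [ProperSpace F] in
include hquasi in
lemma fixed_comap_conj {W : Subgroup (Grp n F × Grp n F)}
    (hD : ∀ c ∈ W, ∀ f, D (testTwoSided c f) = D f) {c : Grp n F × Grp n F}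
    (hc : c ∈ borelProdConjShalika n F) :
    ∀ g ∈ W.comap (MulAut.conj c).toMonoidHom, ∀ f, D (testTwoSided g f) = D f := by
  intro g hg f
  obtain ⟨z, hz⟩ := hquasi c⁻¹ ((borelProdConjShalika n F).inv_mem hc)
  have hg' : c * g * c⁻¹ ∈ W := hg
  have h1 : testTwoSided g f = testTwoSided c⁻¹ (testTwoSided (c * g * c⁻¹) (testTwoSided c f)) := by
    rw [← testTwoSided_mul, ← testTwoSided_mul]
    congr 1
    group
  have h2 : f = testTwoSided c⁻¹ (testTwoSided c f) := by
    rw [← testTwoSided_mul, inv_mul_cancel, testTwoSided_one]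
  rw [h1, hz, hD _ hg']
  conv_rhs => rw [h2, hz]

variable {a : Grp n F} (haP : a ∈ borelSubgroup n F) (haH : a ∈ conjShalika n F)
  (hainv : transposeInvRev n F a = a⁻¹) {z : ℂ} (hz1 : z ≠ 1)
  (hz : ∀ f, D (testTwoSided (a, a) f) = z * D f)

include hquasi hfix haP haH hainv hz1 hz in
/-- The comparison of an orbit with its conjugate by a torus element on which `D` has a nontrivial
character. -/
lemma apply_orbitTest_pairCongruence (ε : Set.Ioo (0 : ℝ) 1) :
    D (orbitTest (pairCongruence n F ε) (isCompactOpenIn_pairCongruence ε)) = 0 := by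
  set W := pairCongruence n F ε with hW
  have haa : (a, a) ∈ borelProdConjShalika n F := ⟨haP, haH⟩
  set V := W.comap (MulAut.conj (a, a)).toMonoidHom with hV
  have hWo : IsCompactOpenIn W := isCompactOpenIn_pairCongruence ε
  have hVo : IsCompactOpenIn V := hWo.comap_conj haa
  -- The stabilizer of `1` is the diagonal copy of the commutative group `P ∩ H`, so it commutes
  -- with `(a, a)`. Hence `W` and `V` meet it in the same subgroup, and the multiplicities below are
  -- both `1`.
  have hconj : ∀ g ∈ borelProdConjShalika n F, g • (1 : Grp n F) = 1 →
      (a, a) * g * (a, a)⁻¹ = g := by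
    intro g hg hg1
    have h12 : g.1 = g.2 := by
      simpa [twoSided_smul, mul_inv_eq_one] using hg1
    have hcomm : Commute a g.1 :=
      commute_of_mem_borel_inf_conjShalika haP haH hg.1 (by rw [h12]; exact hg.2)
    have h1 : a * g.1 * a⁻¹ = g.1 := by rw [hcomm.eq, mul_inv_cancel_right]
    exact Prod.ext h1 (by rw [← h12]; change a * g.2 * a⁻¹ = g.1; rw [← h12]; exact h1)
  have hWV : ∀ g ∈ borelProdConjShalika n F, g • (1 : Grp n F) = 1 → (g ∈ W ↔ g ∈ V) := by
    intro g hg hg1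
    change g ∈ W ↔ (a, a) * g * (a, a)⁻¹ ∈ W
    rw [hconj g hg hg1]
  obtain ⟨m, -, hm, h1⟩ := exists_card_mul_orbitTest hWo (hWo.inf hVo) inf_le_left (hfix ε)
  obtain ⟨m', -, hm', h2⟩ := exists_card_mul_orbitTest hVo (hWo.inf hVo) inf_le_right
    (fixed_comap_conj hquasi (hfix ε) haa)
  rw [hm fun g hg hg1 => ⟨hg, (hWV g (hWo.le hg) hg1).1 hg⟩, Nat.cast_one, one_mul] at h1
  rw [hm' fun g hg hg1 => ⟨(hWV g (hVo.le hg) hg1).2 hg, hg⟩, Nat.cast_one, one_mul] at h2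
  -- `W ⊓ V` has the same index in `W` as in `V`, so `D` takes equal values on the two orbit
  -- indicators.
  rw [Subgroup.inf_relIndex_left, relIndex_comap_conj_pairCongruence ε hainv] at h1
  rw [Subgroup.inf_relIndex_right] at h2
  have h3 : orbitTest W hWo = testTwoSided (a, a) (orbitTest V hVo) := by
    apply Subtype.ext
    funext x
    rw [testTwoSided_apply]
    change (subgroupOrbit W (1 : Grp n F)).indicator (1 : Grp n F → ℂ) x =
      (subgroupOrbit V (1 : Grp n F)).indicator (1 : Grp n F → ℂ) ((a, a)⁻¹ • x)
    have h4 : ((a, a)⁻¹ • x ∈ subgroupOrbit V (1 : Grp n F)) ↔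
        x ∈ subgroupOrbit W (1 : Grp n F) := by
      rw [hV, mem_subgroupOrbit_comap_conj, smul_inv_smul]
      have : (a, a) • (1 : Grp n F) = 1 := by simp [twoSided_smul]
      rw [this]
    classical
    rw [Set.indicator_apply, Set.indicator_apply]
    exact if_congr h4.symm rfl rfl
  have h5 : D (orbitTest W hWo) = z * D (orbitTest W hWo) := by
    conv_lhs => rw [h3, hz, ← h2, h1]
  have h6 : (1 - z) * D (orbitTest W hWo) = 0 := by
    rw [sub_mul, one_mul, ← h5, sub_self]
  exact (mul_eq_zero.1 h6).resolve_left (sub_ne_zero.2 hz1.symm)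

-- Passes from congruence subgroups to arbitrary `W`: the two values of `D` differ by factors, and
-- the one on the side of `W` is nonzero.
include hquasi hfix haP haH hainv hz1 hz in
lemma apply_orbitTest_of_fixed {W : Subgroup (Grp n F × Grp n F)} (h : IsCompactOpenIn W)
    (hD : ∀ c ∈ W, ∀ f, D (testTwoSided c f) = D f) : D (orbitTest W h) = 0 := by
  obtain ⟨δ, hδ⟩ := h.exists_le
  obtain ⟨m, hm, -, h1⟩ :=
    exists_card_mul_orbitTest h (isCompactOpenIn_pairCongruence δ) hδ hD
  rw [apply_orbitTest_pairCongruence hquasi hfix haP haH hainv hz1 hz δ, mul_zero] at h1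
  exact (mul_eq_zero.1 h1.symm).resolve_left (Nat.cast_ne_zero.2 hm)

include hquasi hfix haP haH hainv hz1 hz in
/-- The indicator function of the orbit of a point of `P · H` under a congruence subgroup of
`P × H` is a test function killed by `D`. -/
lemma exists_testFunction_indicator_orbit (ε : Set.Ioo (0 : ℝ) 1) {x : Grp n F}
    (hx : x ∈ openOrbit n F) :
    ∃ e : testFunctions n F, D e = 0 ∧ IsOpen (subgroupOrbit (pairCongruence n F ε) x) ∧
      (e : Grp n F → ℂ) = (subgroupOrbit (pairCongruence n F ε) x).indicator 1 := by
  obtain ⟨c, hc, rfl⟩ := exists_smul_one_of_mem_openOrbit hx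
  have hV := (isCompactOpenIn_pairCongruence (n := n) (F := F) ε).comap_conj hc
  obtain ⟨y, hy⟩ := hquasi c hc
  have hmem : ∀ x : Grp n F, (c⁻¹ • x ∈ subgroupOrbit ((pairCongruence n F ε).comap
      (MulAut.conj c).toMonoidHom) (1 : Grp n F)) ↔
      x ∈ subgroupOrbit (pairCongruence n F ε) (c • (1 : Grp n F)) := by
    intro x
    rw [mem_subgroupOrbit_comap_conj, smul_inv_smul]
  refine ⟨testTwoSided c (orbitTest _ hV), ?_, ?_, ?_⟩
  · rw [hy, apply_orbitTest_of_fixed hquasi hfix haP haH hainv hz1 hz hV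
      (fixed_comap_conj hquasi (hfix ε) hc), mul_zero]
  · have h : subgroupOrbit (pairCongruence n F ε) (c • (1 : Grp n F)) =
        (fun x => c⁻¹ • x) ⁻¹' subgroupOrbit ((pairCongruence n F ε).comap
          (MulAut.conj c).toMonoidHom) (1 : Grp n F) := by
      ext x
      exact (hmem x).symm
    rw [h]
    exact hV.isOpen_orbit.preimage (continuous_twoSided_smul_right _)
  · funext x
    rw [testTwoSided_apply]
    classical
    change Set.indicator _ _ _ = _
    rw [Set.indicator_apply, Set.indicator_apply]
    exact if_congr (hmem x) rfl rfl

omit [IsUltrametricDist F] [ProperSpace F] in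
lemma exists_left_invariant (f : testFunctions n F) :
    ∃ U ∈ nhds (1 : Grp n F), ∀ u ∈ U, ∀ x, (f : Grp n F → ℂ) (u * x) = (f : Grp n F → ℂ) x := by
  let f' : testFunctions n F := ⟨fun x => (f : Grp n F → ℂ) x⁻¹,
    f.2.1.comp_continuous continuous_inv, f.2.2.comp_homeomorph (Homeomorph.inv _)⟩
  obtain ⟨U, hU, h⟩ := exists_right_invariant f'
  refine ⟨U⁻¹, inv_mem_nhds_one _ hU, fun u hu x => ?_⟩
  have h1 := h _ hu x⁻¹
  change (f : Grp n F → ℂ) (x⁻¹ * u⁻¹)⁻¹ = (f : Grp n F → ℂ) x⁻¹⁻¹ at h1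
  rwa [mul_inv_rev, inv_inv, inv_inv] at h1

-- Induction on the number of orbits: an invariant function is constant on an orbit, so subtracting
-- a multiple of that orbit's indicator removes it from the support without changing the value of
-- `D`.
include hquasi hfix haP haH hainv hz1 hz in
lemma apply_eq_zero_of_support_subset_biUnion (ε : Set.Ioo (0 : ℝ) 1) (t : Finset (Grp n F)) :
    (∀ x ∈ t, x ∈ openOrbit n F) → ∀ f : testFunctions n F,
      (∀ c ∈ pairCongruence n F ε, ∀ x, (f : Grp n F → ℂ) (c • x) = (f : Grp n F → ℂ) x) →
      Function.support (f : Grp n F → ℂ) ⊆ ⋃ x ∈ t, subgroupOrbit (pairCongruence n F ε) x →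
      D f = 0 := by
  classical
  induction t using Finset.induction_on with
  | empty =>
    intro _ f _ hf
    have h : f = 0 := by
      apply Subtype.ext
      funext x
      by_contra hx
      simpa using hf hx
    rw [h, map_zero]
  | insert x t _ ih =>
    intro ht f hinv hf
    obtain ⟨e, he, -, hex⟩ := exists_testFunction_indicator_orbit hquasi hfix haP haH hainv hz1 hz ε
      (ht x (Finset.mem_insert_self _ _))
    have hval : ∀ y, ((f - (f : Grp n F → ℂ) x • e : testFunctions n F) : Grp n F → ℂ) y =
        (f : Grp n F → ℂ) y - (f : Grp n F → ℂ) x *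
          (subgroupOrbit (pairCongruence n F ε) x).indicator 1 y := by
      intro y
      rw [← hex]
      rfl
    have h := ih (fun y hy => ht y (Finset.mem_insert_of_mem hy)) (f - (f : Grp n F → ℂ) x • e) ?_ ?_
    · rw [map_sub, map_smul, he, smul_zero, sub_zero] at h
      exact h
    · intro c hc y
      rw [hval, hval, hinv c hc, Set.indicator_apply, Set.indicator_apply]
      simp only [smul_mem_subgroupOrbit hc, Pi.one_apply]
    · intro y hy
      rw [Function.mem_support, hval] at hy
      by_cases hyx : y ∈ subgroupOrbit (pairCongruence n F ε) x
      · exfalso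
        rw [Set.indicator_of_mem hyx] at hy
        obtain ⟨c, hc, rfl⟩ := hyx
        rw [hinv c hc] at hy
        simp at hy
      · rw [Set.indicator_of_notMem hyx, mul_zero, sub_zero] at hy
        have h1 := hf hy
        rw [Finset.set_biUnion_insert] at h1
        exact h1.resolve_left hyx

include hquasi hfix haP haH hainv hz1 hz in
/-- A distribution which is equivariant under `P × H`, with a character which is trivial on
congruence subgroups and nontrivial at a suitable element of the stabilizer of `1`, vanishes on
test functions supported in `P · H`. -/
theorem supportedAwayFrom_openOrbit : SupportedAwayFrom D (openOrbit n F) := by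
  intro f hf
  obtain ⟨U, hU, hUf⟩ := exists_left_invariant f
  obtain ⟨V, hV, hVf⟩ := exists_right_invariant f
  obtain ⟨ε, hε⟩ := exists_congruenceSubgroup_subset (Filter.inter_mem hU hV)
  have hcpt : IsCompact (Function.support (f : Grp n F → ℂ)) := by
    have h : IsClosed (Function.support (f : Grp n F → ℂ)) :=
      (f.2.1.isClopen_fiber 0).compl.isClosed
    rw [← h.closure_eq]
    exact f.2.2
  obtain ⟨t, ht, hcov⟩ := hcpt.elim_nhds_subcover
    (fun x => subgroupOrbit (pairCongruence n F ε) x) fun x hx => by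
      obtain ⟨-, -, ho, -⟩ := exists_testFunction_indicator_orbit hquasi hfix haP haH hainv hz1 hz ε
        (hf hx)
      exact ho.mem_nhds (self_mem_subgroupOrbit _ _)
  refine apply_eq_zero_of_support_subset_biUnion hquasi hfix haP haH hainv hz1 hz ε t
    (fun x hx => hf (ht x hx)) f (fun c hc x => ?_) hcov
  rw [twoSided_smul, hVf _ (hε ((congruenceSubgroup n F ε).inv_mem hc.2.2)).2,
    hUf _ (hε hc.2.1).1]

end Vanishing

end OpenOrbit

/-! ### Genericity of the parameter, and the distributions behind the two assertions -/

section Coefficients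

variable {F : Type*} [NontriviallyNormedField F] {n : ℕ}

/-! ### Weyl translates of symplectic parameters -/

lemma symplecticParam_revIdx (χ : Fin n → Fˣ →* ℂˣ) (i : Idx n) :
    symplecticParam χ (revIdx n i) = (symplecticParam χ i)⁻¹ := by
  rcases i with i | i <;> ext x <;> simp [symplecticParam]

/-- The second alternative cannot be dropped: `χ i = (χ i)⁻¹` is allowed, and then the parameter
agrees at `i` and its reversal. -/
lemma eq_or_eq_revIdx_of_symplecticParam_eq {χ : Fin n → Fˣ →* ℂˣ}
    (hgen : ∀ i j, i ≠ j → χ i ≠ χ j ∧ χ i ≠ (χ j)⁻¹) {a b : Idx n}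
    (h : symplecticParam χ a = symplecticParam χ b) : a = b ∨ a = revIdx n b := by
  have h1 : ∀ i j, χ i = χ j → i = j := fun i j h => by
    by_contra hij
    exact (hgen i j hij).1 h
  have h2 : ∀ i j, χ i = (χ j)⁻¹ → i = j := fun i j h => by
    by_contra hij
    exact (hgen i j hij).2 h
  rcases a with i | i <;> rcases b with j | j <;>
    simp only [symplecticParam, Sum.elim_inl, Sum.elim_inr] at h
  · exact Or.inl (congrArg _ (h1 _ _ h))
  · exact Or.inr (congrArg Sum.inl (h2 _ _ h))
  · refine Or.inr (congrArg Sum.inr ?_)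
    rw [h2 j i.rev h.symm, Fin.revPerm_apply, Fin.rev_rev]
  · exact Or.inl (congrArg Sum.inr (Fin.rev_injective (h1 _ _ (inv_injective h))))

lemma exists_weylAct_revIdx_ne {χ : Fin n → Fˣ →* ℂˣ}
    (hgen : ∀ i j, i ≠ j → χ i ≠ χ j ∧ χ i ≠ (χ j)⁻¹) {w : Equiv.Perm (Idx n)}
    (hw : w ∉ spWeyl n) :
    ∃ i, weylAct w (symplecticParam χ) (revIdx n i) ≠ (weylAct w (symplecticParam χ) i)⁻¹ := by
  by_contra! hcon
  have hcomm : ∀ i, w⁻¹ (revIdx n i) = revIdx n (w⁻¹ i) := by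
    intro i
    have h := hcon i
    simp only [weylAct] at h
    rw [← symplecticParam_revIdx] at h
    refine (eq_or_eq_revIdx_of_symplecticParam_eq hgen h).resolve_right fun h2 => ?_
    rw [revIdx_revIdx] at h2
    -- The second alternative would give `w⁻¹ (revIdx n i) = w⁻¹ i`, but reversal has no fixed
    -- index.
    exact revIdx_ne i (w⁻¹.injective h2)
  refine hw ?_
  rw [← inv_mem_iff, spWeyl, Subgroup.mem_centralizer_singleton_iff]
  ext1 i
  exact hcomm i

lemma isUnramified_weylAct_symplecticParam {χ : Fin n → Fˣ →* ℂˣ} (hχ : ∀ i, IsUnramified (χ i))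
    (w : Equiv.Perm (Idx n)) (i : Idx n) : IsUnramified (weylAct w (symplecticParam χ) i) := by
  have h : ∀ k, IsUnramified (symplecticParam χ k) := by
    rintro (k | k) u hu
    · exact hχ k u hu
    · simp [symplecticParam, hχ _ u hu]
  exact h _

/-! ### Right equivariance under `H` -/

/-- Equivariance of a distribution under right translation by `H`, with the character
`ξ s ξ⁻¹ ↦ Ψ(s)`. -/
def IsShalikaEquivariant (ψ : AddChar F Circle) (D : testFunctions n F → ℂ) : Prop :=
  ∀ (g : Matrix.GeneralLinearGroup (Fin n) F) (X : Matrix (Fin n) (Fin n) F)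
    (f : testFunctions n F),
    D (testRight (xi n F * shalikaElt g X * (xi n F)⁻¹) f) = (ψ X.trace : ℂ) * D f

lemma mul_apply_of_xi_conj (g : Matrix.GeneralLinearGroup (Fin n) F)
    (X : Matrix (Fin n) (Fin n) F) (i j : Fin n) :
    ((g : Matrix (Fin n) (Fin n) F) * X) i j =
      (xi n F * shalikaElt g X * (xi n F)⁻¹ : Grp n F) (Sum.inr i.rev) (Sum.inl j) := by
  rw [coe_xi_conj, Matrix.fromBlocks_apply₂₁, antidiag_mul_apply, Fin.rev_rev]

/-- The blocks of the conjugated matrix show that `g` is close to `1` and `g X` is integral, so `X =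
g⁻¹ (g X)` has integral trace. -/
lemma psi_trace_eq_one_of_mem_congruenceSubgroup [IsUltrametricDist F] {ψ : AddChar F Circle}
    (hψ : HasConductorIntegers ψ) {ε : Set.Ioo (0 : ℝ) 1}
    {g : Matrix.GeneralLinearGroup (Fin n) F} {X : Matrix (Fin n) (Fin n) F}
    (h : xi n F * shalikaElt g X * (xi n F)⁻¹ ∈ congruenceSubgroup n F ε) : ψ X.trace = 1 := by
  have hg : EntryBound ((g : Matrix (Fin n) (Fin n) F) - 1) ε := by
    intro i j
    have h1 := h (Sum.inl i) (Sum.inl j)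
    rw [Matrix.sub_apply, coe_xi_conj, Matrix.fromBlocks_apply₁₁] at h1
    simpa [Matrix.one_apply] using h1
  have hgX : EntryBound ((g : Matrix (Fin n) (Fin n) F) * X) 1 := by
    intro i j
    rw [mul_apply_of_xi_conj]
    exact EntryBound.of_sub_one h ε.2.2.le _ _
  have hginv := (hg.of_mul_eq_one ε.2.2 g.mul_inv).of_sub_one ε.2.2.le
  have hX := hginv.mul hgX zero_le_one zero_le_one
  rw [← mul_assoc, Units.inv_mul, one_mul, mul_one] at hX
  have htr : ‖X.trace‖ ≤ 1 :=
    IsUltrametricDist.norm_sum_le_of_forall_le_of_nonneg zero_le_one fun i _ => hX i i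
  simpa using (hψ X.trace).2 htr 1 (by simp)

lemma diagPart_torusElt (t : Idx n → Fˣ) :
    diagPart ⟨torusElt t, torusElt_mem_borel t⟩ = t := by
  funext i
  apply Units.ext
  exact Matrix.diagonal_apply_eq _ i

lemma borelChar_torusElt (η : Idx n → Fˣ →* ℂˣ) (t : Idx n → Fˣ) :
    borelChar η ⟨torusElt t, torusElt_mem_borel t⟩ = ∏ i, η i (t i) := by
  change ∏ i, η i (diagPart _ i) = _
  rw [diagPart_torusElt]

lemma norm_zpow_neg_le_of_antitone {ϖ : Fˣ} (hϖ : IsUniformizer ϖ) {l : Fin n → ℤ}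
    (hl : Antitone l) (i j : Fin n) (hij : i ≤ j) :
    ‖((ϖ ^ (-l j) : Fˣ) : F)‖ ≤ ‖((ϖ ^ (-l i) : Fˣ) : F)‖ := by
  rw [Units.val_zpow_eq_zpow_val, Units.val_zpow_eq_zpow_val, norm_zpow, norm_zpow]
  exact zpow_le_zpow_right_of_le_one₀ (norm_pos_iff.2 ϖ.ne_zero) hϖ.1.le
    (neg_le_neg (hl hij))

variable [ProperSpace F]

/-! ### Translation of vectors of the principal series -/

lemma proj_testRight (χ : Idx n → Fˣ →* ℂˣ) (g : Grp n F) (f : testFunctions n F) :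
    proj χ (testRight g f) = rightTranslate g (proj χ f) := by
  apply Subtype.ext
  funext x
  refine integral_congr_ae (Filter.Eventually.of_forall fun p => ?_)
  change _ * (f : Grp n F → ℂ) (p * x * g) = _ * (f : Grp n F → ℂ) (p * (x * g))
  rw [mul_assoc (p : Grp n F)]

lemma rightTranslate_mul {χ : Idx n → Fˣ →* ℂˣ} (g h : Grp n F) (φ : principalSeries χ) :
    rightTranslate (g * h) φ = rightTranslate g (rightTranslate h φ) := by
  apply Subtype.ext
  funext x
  change (φ : Grp n F → ℂ) (x * (g * h)) = (φ : Grp n F → ℂ) (x * g * h)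
  rw [mul_assoc]

lemma functionalH_rightTranslate {ψ : AddChar F Circle} {χ : Idx n → Fˣ →* ℂˣ}
    {Λ : principalSeries χ →ₗ[ℂ] ℂ} (hΛ : IsShalikaFunctional ψ Λ)
    (g : Matrix.GeneralLinearGroup (Fin n) F) (X : Matrix (Fin n) (Fin n) F)
    (φ : principalSeries χ) :
    functionalH Λ (rightTranslate (xi n F * shalikaElt g X * (xi n F)⁻¹) φ) =
      (ψ X.trace : ℂ) * functionalH Λ φ := by
  change Λ (rightTranslate (xi n F)⁻¹ (rightTranslate _ φ)) =
    _ * Λ (rightTranslate (xi n F)⁻¹ φ)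
  rw [← hΛ g X, ← rightTranslate_mul, ← rightTranslate_mul]
  congr 2
  group

/-! ### Convolutions with the distribution of a Shalika functional -/

/-- The vector `x ↦ D(f(x⁻¹ ·))` of `I(χ⁻¹)` attached to a left equivariant distribution `D` and a
test function `f`. -/
def distVector {χ : Idx n → Fˣ →* ℂˣ} (D : testFunctions n F →ₗ[ℂ] ℂ)
    (hD : IsLeftEquivariant χ D) : testFunctions n F →ₗ[ℂ] principalSeries χ⁻¹ where
  toFun f := ⟨fun x => D (testLeft x f), by
    constructor
    · obtain ⟨U, hU, hf⟩ := exists_left_invariant f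
      rw [IsLocallyConstant.iff_eventually_eq]
      intro x
      have h : ∀ᶠ y in nhds x, y⁻¹ * x ∈ U := by
        have hc : Filter.Tendsto (fun y => y⁻¹ * x) (nhds x) (nhds 1) := by
          have h1 : Continuous fun y : Grp n F => y⁻¹ * x := by fun_prop
          simpa using h1.tendsto x
        exact hc hU
      filter_upwards [h] with y hy
      congr 1
      apply Subtype.ext
      funext z
      change (f : Grp n F → ℂ) (y⁻¹ * z) = (f : Grp n F → ℂ) (x⁻¹ * z)
      rw [← hf _ hy (x⁻¹ * z), mul_assoc, mul_inv_cancel_left]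
    · intro p x
      have h : testLeft ((p : Grp n F) * x) f = testLeft (p : Grp n F) (testLeft x f) := by
        apply Subtype.ext
        funext y
        simp [testLeft, mul_assoc]
      change D (testLeft ((p : Grp n F) * x) f) = _
      rw [h, hD p]
      congr 2
      simp [borelChar]⟩
  map_add' f f' := by
    apply Subtype.ext
    funext x
    exact map_add D (testLeft x f) (testLeft x f')
  map_smul' c f := by
    apply Subtype.ext
    funext x
    exact map_smul D c (testLeft x f)

lemma distVector_testLeft {χ : Idx n → Fˣ →* ℂˣ} {D : testFunctions n F →ₗ[ℂ] ℂ}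
    (hD : IsLeftEquivariant χ D) (g : Grp n F) (f : testFunctions n F) :
    distVector D hD (testLeft g f) = rightTranslate g (distVector D hD f) := by
  apply Subtype.ext
  funext x
  refine congrArg D (Subtype.ext (funext fun y => ?_))
  simp [testLeft, mul_assoc]

lemma distVector_testRight {ψ : AddChar F Circle} {χ : Idx n → Fˣ →* ℂˣ}
    {D : testFunctions n F →ₗ[ℂ] ℂ} (hD : IsLeftEquivariant χ D) (hψD : IsShalikaEquivariant ψ D)
    (g : Matrix.GeneralLinearGroup (Fin n) F) (X : Matrix (Fin n) (Fin n) F)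
    (f : testFunctions n F) :
    distVector D hD (testRight (xi n F * shalikaElt g X * (xi n F)⁻¹) f) =
      (ψ X.trace : ℂ) • distVector D hD f := by
  apply Subtype.ext
  funext x
  refine Eq.trans (congrArg D (Subtype.ext (funext fun y => ?_))) (hψD g X (testLeft x f))
  simp [testLeft, testRight, mul_assoc]

/-- Evaluation at `1` of an intertwining operator applied to the vectors of an equivariant
distribution. -/
def intertwinedDist {χ χ' : Idx n → Fˣ →* ℂˣ} (D : testFunctions n F →ₗ[ℂ] ℂ)
    (hD : IsLeftEquivariant χ D) (T : principalSeries χ⁻¹ →ₗ[ℂ] principalSeries χ') :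
    testFunctions n F →ₗ[ℂ] ℂ :=
  LinearMap.proj 1 ∘ₗ (principalSeries χ').subtype ∘ₗ T ∘ₗ distVector D hD

lemma intertwinedDist_apply {χ χ' : Idx n → Fˣ →* ℂˣ} (D : testFunctions n F →ₗ[ℂ] ℂ)
    (hD : IsLeftEquivariant χ D) (T : principalSeries χ⁻¹ →ₗ[ℂ] principalSeries χ')
    (f : testFunctions n F) :
    intertwinedDist D hD T f = (T (distVector D hD f) : Grp n F → ℂ) 1 := rfl

/-- Left translation of the test function becomes right translation in `I(χ⁻¹)`, which `T` carries
to `I(χ'⁻¹)`; at `1`, right translation by `p` is the same as left translation, where the defining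
law of `I(χ'⁻¹)` applies. -/
lemma intertwinedDist_leftEquivariant {χ χ' : Idx n → Fˣ →* ℂˣ}
    {D : testFunctions n F →ₗ[ℂ] ℂ} (hD : IsLeftEquivariant χ D)
    {T : principalSeries χ⁻¹ →ₗ[ℂ] principalSeries χ'⁻¹} (hT : IsIntertwining T) :
    IsLeftEquivariant χ' (intertwinedDist D hD T) := by
  intro p f
  rw [intertwinedDist_apply, intertwinedDist_apply, distVector_testLeft, hT]
  have h := (T (distVector D hD f)).2.2 p 1
  change (T (distVector D hD f) : Grp n F → ℂ) (1 * p) = _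
  rw [one_mul, ← mul_one (p : Grp n F), h]
  congr 2
  simp [borelChar]

/-- The right action of `H` only scales the vector attached to `D`, so linearity of `T` is enough.
-/
lemma intertwinedDist_shalikaEquivariant {ψ : AddChar F Circle} {χ χ' : Idx n → Fˣ →* ℂˣ}
    {D : testFunctions n F →ₗ[ℂ] ℂ} (hD : IsLeftEquivariant χ D) (hψD : IsShalikaEquivariant ψ D)
    (T : principalSeries χ⁻¹ →ₗ[ℂ] principalSeries χ') :
    IsShalikaEquivariant ψ (intertwinedDist D hD T) := by
  intro g X f
  rw [intertwinedDist_apply, intertwinedDist_apply, distVector_testRight hD hψD, map_smul]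
  rfl

variable [IsUltrametricDist F]

/-! ### Vanishing for Weyl translates and Casselman coefficients -/

/-- Equivariant distributions for a Weyl translate of a generic symplectic parameter outside the
symplectic Weyl group vanish on the open orbit. -/
theorem supportedAwayFrom_openOrbit_of_notMem_spWeyl {ψ : AddChar F Circle}
    (hψ : HasConductorIntegers ψ) {χ : Fin n → Fˣ →* ℂˣ} (hχ : ∀ i, IsUnramified (χ i))
    (hgen : ∀ i j, i ≠ j → χ i ≠ χ j ∧ χ i ≠ (χ j)⁻¹) {w : Equiv.Perm (Idx n)}
    (hw : w ∉ spWeyl n) {D : testFunctions n F →ₗ[ℂ] ℂ}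
    (hleft : IsLeftEquivariant (weylAct w (symplecticParam χ)) D)
    (hright : IsShalikaEquivariant ψ D) : SupportedAwayFrom D (openOrbit n F) := by
  obtain ⟨i, hi⟩ := exists_weylAct_revIdx_ne hgen hw
  have hη := isUnramified_weylAct_symplecticParam hχ w
  set η := weylAct w (symplecticParam χ)
  have happ : ∀ (p : borelSubgroup n F) (g : Matrix.GeneralLinearGroup (Fin n) F)
      (X : Matrix (Fin n) (Fin n) F) (f : testFunctions n F),
      D (testTwoSided (↑p, xi n F * shalikaElt g X * (xi n F)⁻¹) f) =
        ((((borelChar η p)⁻¹ : ℂˣ) : ℂ) * sqrtDelta p * ψ X.trace) * D f := by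
    intro p g X f
    rw [testTwoSided, hleft p, hright g X, ← mul_assoc]
  have hquasi : ∀ c ∈ borelProdConjShalika n F, ∃ z : ℂ, ∀ f, D (testTwoSided c f) = z * D f := by
    rintro ⟨p, h⟩ ⟨hp, hh⟩
    obtain ⟨g, X, rfl⟩ := mem_conjShalika_iff_exists.1 hh
    exact ⟨_, happ ⟨p, hp⟩ g X⟩
  have hfix : ∀ ε, ∀ c ∈ pairCongruence n F ε, ∀ f, D (testTwoSided c f) = D f := by
    rintro ε ⟨p, h⟩ ⟨⟨hp, hh⟩, hpK, hhK⟩ f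
    obtain ⟨g, X, rfl⟩ := mem_conjShalika_iff_exists.1 hh
    have h1 := happ ⟨p, hp⟩ g X f
    rw [borelChar_eq_one_of_mem hη (p := ⟨p, hp⟩) hpK, sqrtDelta_eq_one_of_mem (p := ⟨p, hp⟩) hpK,
      psi_trace_eq_one_of_mem_congruenceSubgroup hψ hhK] at h1
    simpa using h1
  obtain ⟨x, hx⟩ : ∃ x, η i x * η (revIdx n i) x ≠ 1 := by
    by_contra! hcon
    exact hi (MonoidHom.ext fun x => eq_inv_of_mul_eq_one_right (hcon x))
  -- A reversal-invariant torus element on which the product of the `η k` reduces to `η i x * η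
  -- (revIdx n i) x`.
  let t : Idx n → Fˣ := fun k => if k = i ∨ k = revIdx n i then x else 1
  have ht : ∀ k, t (revIdx n k) = t k := by
    intro k
    have h1 : (revIdx n k = i ∨ revIdx n k = revIdx n i) ↔ (k = i ∨ k = revIdx n i) := by
      rw [EmbeddingLike.apply_eq_iff_eq, or_comm]
      refine or_congr Iff.rfl ⟨fun h => ?_, fun h => ?_⟩
      · rw [← h, revIdx_revIdx]
      · rw [h, revIdx_revIdx]
    exact if_congr h1 rfl rfl
  have hprod : borelChar η ⟨torusElt t, torusElt_mem_borel t⟩ ≠ 1 := by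
    rw [borelChar_torusElt, Finset.prod_eq_mul i (revIdx n i) (revIdx_ne i).symm
      (fun k _ hk => by simp [t, hk.1, hk.2]) (by simp) (by simp)]
    simpa [t] using hx
  have htH := torusElt_mem_conjShalika ht
  obtain ⟨g, X, hgX⟩ := mem_conjShalika_iff_exists.1 htH
  -- A diagonal element of `H` has zero lower-left block, so the Shalika character is trivial on it.
  have hX : X = 0 := by
    have h1 : (g : Matrix (Fin n) (Fin n) F) * X = 0 := by
      ext i j
      rw [mul_apply_of_xi_conj, ← hgX]
      exact Matrix.diagonal_apply_ne _ (by simp)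
    rw [← one_mul X, ← Units.inv_mul g, mul_assoc, h1, mul_zero]
  have hz := happ ⟨torusElt t, torusElt_mem_borel t⟩ g X
  rw [← hgX, hX, sqrtDelta_torusElt ht] at hz
  refine supportedAwayFrom_openOrbit hquasi hfix (torusElt_mem_borel t) htH
    (transposeInvRev_torusElt ht) ?_ hz
  simpa using hprod

/-- The integrand of `𝒫_χ` is integrable. -/
lemma integrable_proj {χ : Idx n → Fˣ →* ℂˣ} (hχ : ∀ i, IsUnramified (χ i))
    (f : testFunctions n F) (g : Grp n F) :
    Integrable (fun p : borelSubgroup n F => (((borelChar χ p)⁻¹ : ℂˣ) : ℂ) * sqrtDelta p *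
      (f : Grp n F → ℂ) (p * g)) Measure.haar := by
  have hc : Continuous fun p : borelSubgroup n F => (((borelChar χ p)⁻¹ : ℂˣ) : ℂ) := by
    simp only [Units.val_inv_eq_inv_val]
    exact (continuous_borelChar hχ).inv₀ fun p => Units.ne_zero _
  refine Continuous.integrable_of_hasCompactSupport ((hc.mul continuous_sqrtDelta).mul
    (f.2.1.continuous.comp (continuous_subtype_val.mul continuous_const))) ?_
  refine HasCompactSupport.mul_left ?_
  exact (f.2.2.comp_homeomorph (Homeomorph.mulRight g)).comp_isClosedEmbedding
    isClosed_borel.isClosedEmbedding_subtypeVal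

/-- The projection `𝒫_χ` as a linear map. -/
def projLinear (χ : Idx n → Fˣ →* ℂˣ) (hχ : ∀ i, IsUnramified (χ i)) :
    testFunctions n F →ₗ[ℂ] principalSeries χ where
  toFun := proj χ
  map_add' f f' := by
    apply Subtype.ext
    funext g
    refine Eq.trans ?_ (integral_add (integrable_proj hχ f g) (integrable_proj hχ f' g))
    refine integral_congr_ae (Filter.Eventually.of_forall fun p => ?_)
    exact mul_add _ _ _
  map_smul' c f := by
    apply Subtype.ext
    funext g
    refine Eq.trans ?_ (integral_const_mul c _)
    refine integral_congr_ae (Filter.Eventually.of_forall fun p => ?_)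
    exact mul_left_comm _ _ _

lemma coe_projDeltaH_eq_distVector {χ : Idx n → Fˣ →* ℂˣ} (Λ : principalSeries χ →ₗ[ℂ] ℂ)
    {D : testFunctions n F →ₗ[ℂ] ℂ} (hDΛ : ∀ f, D f = deltaH Λ f) (hD : IsLeftEquivariant χ D)
    (g : Grp n F) :
    (projDeltaH Λ g : principalSeries χ⁻¹) =
      distVector D hD (testRight g (cosetIndicator 1)) := by
  apply Subtype.ext
  funext x
  change deltaH Λ (testRight g (cosetIndicator x)) = D (testLeft x (testRight g (cosetIndicator 1)))
  rw [hDΛ]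
  refine congrArg _ (Subtype.ext (funext fun y => ?_))
  simp [testLeft, testRight, cosetIndicator, mul_assoc]

/-- The coordinates with respect to a Casselman basis are the functionals to which it is dual. -/
lemma IsCasselmanBasis.repr_apply {χ : Idx n → Fˣ →* ℂˣ}
    {T : ∀ w : Equiv.Perm (Idx n), principalSeries χ →ₗ[ℂ] principalSeries (weylAct w χ)}
    {f : Module.Basis (Equiv.Perm (Idx n)) ℂ (iwahoriInvariants (n := n) χ)}
    (hf : IsCasselmanBasis T f) (φ : iwahoriInvariants (n := n) χ) (w : Equiv.Perm (Idx n)) :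
    f.repr φ w = (T w (φ : principalSeries χ) : Grp n F → ℂ) 1 := by
  let L : iwahoriInvariants (n := n) χ →ₗ[ℂ] ℂ :=
    LinearMap.proj 1 ∘ₗ (principalSeries (weylAct w χ)).subtype ∘ₗ T w ∘ₗ Submodule.subtype _
  have h : f.coord w = L := by
    refine f.ext fun w' => ?_
    change f.repr (f w') w = (T w (f w' : principalSeries χ) : Grp n F → ℂ) 1
    rw [hf w w', f.repr_self, Finsupp.single_apply]
    simp only [eq_comm]
  exact LinearMap.congr_fun h φ

/-- For dominant `g = diag(t, 1)`, the translate by `g` of the indicator function of the Iwahori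
subgroup is supported in `P · H`. -/
lemma support_testRight_cosetIndicator_subset {t : Fin n → Fˣ}
    (ht : ∀ i j, i ≤ j → ‖(t j : F)‖ ≤ ‖(t i : F)‖) :
    Function.support (testRight (torusElt (Sum.elim t 1)) (cosetIndicator 1) : Grp n F → ℂ) ⊆
      openOrbit n F := by
  intro y hy
  have h : (1 : Grp n F)⁻¹ * (y * torusElt (Sum.elim t 1)) ∈ (iwahori n F : Set (Grp n F)) := by
    by_contra hcon
    exact hy (Set.indicator_of_notMem hcon (fun _ => (1 : ℂ)))
  rw [inv_one, one_mul] at h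
  have h1 := iwahori_mul_inv_mem_openOrbit ht h
  rwa [mul_inv_cancel_right] at h1

end Coefficients

end Shalika

end

/-! ### The two assertions -/

open Shalika in
theorem mainTheorem2 {F : Type*} [NontriviallyNormedField F] [IsUltrametricDist F] [ProperSpace F]
    (n : ℕ) (ψ : AddChar F Circle) (hψ : HasConductorIntegers ψ)
    (χ : Fin n → Fˣ →* ℂˣ) (hχ : ∀ i, IsUnramified (χ i))
    (hgen : ∀ i j, i ≠ j → χ i ≠ χ j ∧ χ i ≠ (χ j)⁻¹)
    (Λ : principalSeries (symplecticParam χ) →ₗ[ℂ] ℂ) (hΛ : IsShalikaFunctional ψ Λ) :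
    (∀ w : Equiv.Perm (Idx n), w ∉ spWeyl n →
      ∀ T : principalSeries (weylAct w (symplecticParam χ)) →ₗ[ℂ]
          principalSeries (symplecticParam χ),
        IsIntertwining T → SupportedAwayFrom (pullbackDeltaH T Λ) (openOrbit n F)) ∧
    (∀ (T : ∀ w : Equiv.Perm (Idx n), principalSeries (symplecticParam χ)⁻¹ →ₗ[ℂ]
          principalSeries (weylAct w (symplecticParam χ)⁻¹))
      (f : Module.Basis (Equiv.Perm (Idx n)) ℂ (iwahoriInvariants (symplecticParam χ)⁻¹)),
        (∀ w, IsIntertwining (T w)) → IsCasselmanBasis T f →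
        ∀ (ϖ : Fˣ), IsUniformizer ϖ → ∀ l : Fin n → ℤ, Antitone l →
          ∀ w : Equiv.Perm (Idx n), w ∉ spWeyl n →
            casselmanCoeff f Λ (gNeg ϖ l) w = 0) := by
  refine ⟨fun w hw T hT => ?_, fun T f hT hf ϖ hϖ l hl w hw => ?_⟩
  · refine supportedAwayFrom_openOrbit_of_notMem_spWeyl hψ hχ hgen hw
      (D := functionalH Λ ∘ₗ T ∘ₗ projLinear _ (isUnramified_weylAct_symplecticParam hχ w))
      (toDistribution_leftEquivariant (functionalH Λ ∘ₗ T)) fun g X f => ?_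
    change functionalH Λ (T (proj _ (testRight _ f))) = _ * functionalH Λ (T (proj _ f))
    rw [proj_testRight, hT, functionalH_rightTranslate hΛ]
  · let D : testFunctions n F →ₗ[ℂ] ℂ := functionalH Λ ∘ₗ
      -- The Weyl element `1` acts trivially by definition, so this is unramifiedness of the
      -- parameter itself.
      projLinear _ (isUnramified_weylAct_symplecticParam hχ 1)
    have hleft : IsLeftEquivariant (symplecticParam χ) D :=
      toDistribution_leftEquivariant (functionalH Λ)
    have hright : IsShalikaEquivariant ψ D := by
      intro g X f
      change functionalH Λ (proj _ (testRight _ f)) = _ * functionalH Λ (proj _ f)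
      rw [proj_testRight, functionalH_rightTranslate hΛ]
    rw [casselmanCoeff, hf.repr_apply,
      coe_projDeltaH_eq_distVector Λ (D := D) (fun _ => rfl) hleft]
    -- The inverse of the Weyl translate is definitionally the Weyl translate of the inverse
    -- parameter, which is how `T w` has the target required here.
    exact supportedAwayFrom_openOrbit_of_notMem_spWeyl hψ hχ hgen hw
      (intertwinedDist_leftEquivariant hleft (hT w))
      (intertwinedDist_shalikaEquivariant hleft hright (T w)) _
      (support_testRight_cosetIndicator_subset (norm_zpow_neg_le_of_antitone hϖ hl))
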